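/- Spaces are $\Delta$-generated topological spaces, and $\mathrm{Top}$ is their category. Let $\mathcal{M}$ be the set of non-decreasing surjective maps $[0,1]\to[0,1]$. A multipointed $d$-space $X$ is a space $|X|$ with a set of states $X^0\subset |X|$ and a set of continuous paths $[0,1]\to|X|$ between states (execution paths) which is stable under precomposition by elements of $\mathcal{M}$ and under normalized composition $*_N$; maps are continuous maps preserving states and execution paths. $\mathbb{P}^{top}_{\alpha,\beta}X$ is the set of execution paths from $\alpha$ to $\beta$ with the $\Delta$-kelleyfication of the compact-open topology, and $\mathbb{P}^{top}X$ is the disjoint sum of these spaces. The globe $\mathrm{Glob}(Z)$ has underlying space $(\{0,1\}\sqcup Z\times[0,1])/((z,0)\sim 0,(z,1)\sim 1)$, states $0,1$ and execution paths $t\mapsto (z,\phi(t))$, $z\in Z$, $\phi\in\mathcal{M}$. A multipointed $d$-space is cellular if it is obtained from a set (with no execution paths) by a transfinite composition of pushouts of maps $\mathrm{Glob}(\mathbf{S}^{n-1})\subset\mathrm{Glob}(\mathbf{D}^{n})$, $n\geq 0$. A map $f:X\to Y$ is a trivial q-fibration if it induces a bijection $X^0\cong Y^0$ and if $\mathbb{P}^{top}f:\mathbb{P}^{top}X\to\mathbb{P}^{top}Y$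 is both a weak homotopy equivalence and a Serre fibration. The directed paths of $X$ are the constant paths and the finite Moore compositions of paths $\gamma\phi$ with $\gamma$ an execution path and $\phi:[0,1]\to[0,1]$ non-decreasing and continuous. The trace space $\vec{T}(X)(a,b)$ is the set of directed paths from $a$ to $b$, with the $\Delta$-kelleyfication of the compact-open topology, modulo the equivalence relation generated by $\gamma\sim\gamma\phi$ for $\phi\in\mathcal{M}$, with the quotient topology; these are the morphisms of a category $\vec{T}(X)$ whose objects are the points of $|X|$. The natural system $\overrightarrow{\mathrm{NT}}(X)$ is the functor to $\mathrm{Top}$, defined on the category of factorizations of $\vec{T}(X)$ (objects: the traces; morphisms: the extensions $\tau\mapsto\alpha*\tau*\beta$), which takes the trace of $\gamma$ to $\vec{T}(X)(\gamma(0),\gamma(1))$ and the extension by $(\alpha,\beta)$ to $\alpha*-*\beta$; a map $f$ induces a map of diagrams $\overrightarrow{\mathrm{NT}}(f)$. A map of diagrams $(h,\mu):(F:I\to\mathrm{Top})\to (G:J\to\mathrm{Top})$, where $h:I\to J$ is a functor and $\mu:F\Rightarrow G h$, is open up to homotopy if $h$ is surjective on objects, every morphism $h(i)\to j'$ of $J$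 is the image under $h$ of some morphism $i\to j$ of $I$, and $\mu$ becomes a natural isomorphism in the homotopy category $\mathbf{Ho}(\mathrm{Top})$ (the localization at the weak homotopy equivalences). **Proposition.** There is a trivial q-fibration $f:A\to B$ between cellular multipointed $d$-spaces such that $\overrightarrow{\mathrm{NT}}(f):\overrightarrow{\mathrm{NT}}(A)\to\overrightarrow{\mathrm{NT}}(B)$ is not open up to homotopy. More precisely, one can take for $B$ the tame realization of the loop-free $1$-dimensional precubical set with four vertices $0,1,2,3$ and four edges $d_1:0\to 1$, $d_2:1\to 2$, $d_3:2\to 3$, $d_4:1\to 2$ (that is, the multipointed $d$-space freely generated by these states and these execution paths), for $A$ the pushout of $\mathrm{Glob}(\{0\})\subset\mathrm{Glob}([0,1])$ along the map $\mathrm{Glob}(\{0\})\to B$ given by the execution path $d_1*_Nd_2*_Nd_3$, and for $f$ the map which is the identity on $B$ and which is the projection $\mathrm{Glob}([0,1])\to\mathrm{Glob}(\{0\})\to B$ on the added globe; and there is then a directed path $\gamma$ of $A$ such that the trace space $\vec{T}(A)(\gamma(0),\gamma(1))$ is contractible, whereas the trace space $\vec{T}(B)(f\gamma(0),f\gamma(1))$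 has exactly two path components. -/

import Mathlib

open CategoryTheory Topology unitInterval

noncomputable section

namespace DAT

/-! ### Reparametrizations of the unit interval -/

/-- Elements of `M(1,1)`: non-decreasing surjective maps from `[0,1]` to itself
(they are automatically continuous). -/
def IsReparam (φ : I → I) : Prop := Monotone φ ∧ Function.Surjective φ

theorem IsReparam.continuous {φ : I → I} (h : IsReparam φ) : Continuous φ :=
  h.1.continuous_of_surjective h.2

theorem IsReparam.zero {φ : I → I} (h : IsReparam φ) : φ 0 = 0 := by
  obtain ⟨t, ht⟩ := h.2 0
  exact le_antisymm (le_of_le_of_eq (h.1 (show (0 : I) ≤ t from t.2.1)) ht) (φ 0).2.1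

theorem IsReparam.one {φ : I → I} (h : IsReparam φ) : φ 1 = 1 := by
  obtain ⟨t, ht⟩ := h.2 1
  exact le_antisymm (φ 1).2.2 (le_of_eq_of_le ht.symm (h.1 (show t ≤ (1 : I) from t.2.2)))

theorem IsReparam.of {φ : I → I} (hm : Monotone φ) (hc : Continuous φ) (h0 : φ 0 = 0)
    (h1 : φ 1 = 1) : IsReparam φ := by
  refine ⟨hm, fun s => ?_⟩
  have := intermediate_value_univ (0 : I) 1 hc
  rw [h0, h1] at this
  exact this ⟨s.2.1, s.2.2⟩

theorem IsReparam.id : IsReparam (fun t => t) := ⟨monotone_id, Function.surjective_id⟩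

theorem IsReparam.comp {φ ψ : I → I} (hφ : IsReparam φ) (hψ : IsReparam ψ) :
    IsReparam (fun t => φ (ψ t)) := ⟨hφ.1.comp hψ.1, hφ.2.comp hψ.2⟩

/-- `t ↦ 2t`, truncated to `[0,1]`. -/
def dblL (t : I) : I := Set.projIcc 0 1 zero_le_one (2 * (t : ℝ))

/-- `t ↦ 2t - 1`, truncated to `[0,1]`. -/
def dblR (t : I) : I := Set.projIcc 0 1 zero_le_one (2 * (t : ℝ) - 1)

theorem dblL_mono : Monotone dblL := fun a b h =>
  Set.monotone_projIcc _ (by have : (a : ℝ) ≤ b := h; linarith)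

theorem dblR_mono : Monotone dblR := fun a b h =>
  Set.monotone_projIcc _ (by have : (a : ℝ) ≤ b := h; linarith)

theorem dblL_continuous : Continuous dblL :=
  continuous_projIcc.comp (by fun_prop)

theorem dblR_continuous : Continuous dblR :=
  continuous_projIcc.comp (by fun_prop)

theorem trans_eq_left {X : Type*} [TopologicalSpace X] {x y z : X} (p : Path x y) (q : Path y z)
    {t : I} (ht : (t : ℝ) ≤ 1 / 2) : p.trans q t = p (dblL t) := by
  rw [Path.trans_apply, dif_pos ht, dblL, Set.projIcc_of_mem]

theorem trans_eq_right {X : Type*} [TopologicalSpace X] {x y z : X} (p : Path x y) (q : Path y z)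
    {t : I} (ht : 1 / 2 ≤ (t : ℝ)) : p.trans q t = q (dblR t) := by
  rcases ht.lt_or_eq with h | h
  · rw [Path.trans_apply, dif_neg (not_le.2 h), dblR, Set.projIcc_of_mem]
  · have h1 : dblL t = 1 := by
      rw [dblL, ← h]; norm_num
    have h2 : dblR t = 0 := by
      rw [dblR, ← h]; norm_num
    rw [trans_eq_left p q h.ge, h1, h2, p.target, q.source]

theorem dblL_mk (u : I) (h : (u : ℝ) / 2 ∈ I) : dblL ⟨(u : ℝ) / 2, h⟩ = u := by
  unfold dblL
  simp only [mul_div_cancel₀ _ (two_ne_zero (α := ℝ)), Set.projIcc_val]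

theorem dblR_mk (u : I) (h : (1 + (u : ℝ)) / 2 ∈ I) : dblR ⟨(1 + (u : ℝ)) / 2, h⟩ = u := by
  unfold dblR
  simp only [mul_div_cancel₀ _ (two_ne_zero (α := ℝ)), add_sub_cancel_left, Set.projIcc_val]

theorem halfL_mem (u : I) : (u : ℝ) / 2 ∈ I := by
  have := u.2; constructor <;> [linarith [this.1]; linarith [this.2]]

theorem halfR_mem (u : I) : (1 + (u : ℝ)) / 2 ∈ I := by
  have := u.2; constructor <;> [linarith [this.1]; linarith [this.2]]

/-- The half-speed concatenation of two elements of `M(1,1)`. -/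
def tensor (φ ψ : I → I) (t : I) : I :=
  if (t : ℝ) ≤ 1 / 2 then ⟨(φ (dblL t) : ℝ) / 2, halfL_mem _⟩
  else ⟨(1 + (ψ (dblR t) : ℝ)) / 2, halfR_mem _⟩

theorem tensor_isReparam {φ ψ : I → I} (hφ : IsReparam φ) (hψ : IsReparam ψ) :
    IsReparam (tensor φ ψ) := by
  refine ⟨fun a b hab => ?_, fun s => ?_⟩
  · have hab' : (a : ℝ) ≤ b := hab
    unfold tensor
    split_ifs with h1 h2 h2
    · have : (φ (dblL a) : ℝ) ≤ φ (dblL b) := hφ.1 (dblL_mono hab)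
      exact Subtype.mk_le_mk.2 (by linarith)
    · have h3 := (φ (dblL a)).2.2
      have h4 := (ψ (dblR b)).2.1
      exact Subtype.mk_le_mk.2 (by linarith)
    · exact absurd (hab'.trans h2) h1
    · have : (ψ (dblR a) : ℝ) ≤ ψ (dblR b) := hψ.1 (dblR_mono hab)
      exact Subtype.mk_le_mk.2 (by linarith)
  · have hs := s.2
    by_cases h : (s : ℝ) ≤ 1 / 2
    · obtain ⟨u, hu⟩ := hφ.2 ⟨2 * (s : ℝ), by constructor <;> linarith [hs.1]⟩
      have hu2 := u.2
      refine ⟨⟨(u : ℝ) / 2, by constructor <;> linarith [hu2.1, hu2.2]⟩, ?_⟩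
      have h1 : dblL ⟨(u : ℝ) / 2, by constructor <;> linarith [hu2.1, hu2.2]⟩ = u := dblL_mk u _
      unfold tensor
      rw [if_pos (by show (u : ℝ) / 2 ≤ 1 / 2; linarith [hu2.2])]
      ext
      simp only [h1, hu]; ring
    · push Not at h
      obtain ⟨u, hu⟩ := hψ.2 ⟨2 * (s : ℝ) - 1, by constructor <;> linarith [hs.2]⟩
      have hu2 := u.2
      have hu0 : 0 < (u : ℝ) := by
        rcases hu2.1.lt_or_eq with h' | h'
        · exact h'
        · exfalso
          have : u = 0 := Subtype.ext h'.symm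
          rw [this, hψ.zero] at hu
          have := congrArg Subtype.val hu
          simp at this
          linarith
      refine ⟨⟨(1 + (u : ℝ)) / 2, by constructor <;> linarith [hu2.1, hu2.2]⟩, ?_⟩
      have h1 : dblR ⟨(1 + (u : ℝ)) / 2, by constructor <;> linarith [hu2.1, hu2.2]⟩ = u := dblR_mk u _
      unfold tensor
      rw [if_neg (by show ¬ (1 + (u : ℝ)) / 2 ≤ 1 / 2; linarith)]
      ext
      simp only [h1, hu]; ring

theorem trans_tensor {X : Type*} [TopologicalSpace X] {x y z : X} {p p' : Path x y}
    {q q' : Path y z} {φ ψ : I → I} (hp : ∀ t, p' t = p (φ t))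
    (hq : ∀ t, q' t = q (ψ t)) (t : I) :
    p'.trans q' t = p.trans q (tensor φ ψ t) := by
  by_cases h : (t : ℝ) ≤ 1 / 2
  · have h1 := (φ (dblL t)).2
    rw [trans_eq_left _ _ h, hp]
    unfold tensor
    rw [if_pos h, trans_eq_left _ _ (by show (φ (dblL t) : ℝ) / 2 ≤ 1 / 2; linarith [h1.2])]
    rw [dblL_mk]
  · have h1 := (ψ (dblR t)).2
    rw [trans_eq_right _ _ (not_le.1 h).le, hq]
    unfold tensor
    rw [if_neg h, trans_eq_right _ _
      (by show 1 / 2 ≤ (1 + (ψ (dblR t) : ℝ)) / 2; linarith [h1.1])]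
    rw [dblR_mk]

/-! ### Delta-generated spaces -/

instance instDeltaGeneratedUnitInterval : DeltaGeneratedSpace I := by
  have hq : IsQuotientMap (fun v : Fin 1 → ℝ => Set.projIcc (0 : ℝ) 1 zero_le_one (v 0)) :=
    IsQuotientMap.of_inverse (f := fun (t : I) (_ : Fin 1) => (t : ℝ)) (by fun_prop)
      (continuous_projIcc.comp (continuous_apply 0)) (fun t => Set.projIcc_val _ t)
  exact hq.isGeneratedBy

instance instDeltaGeneratedOfDiscrete {S : Type*} [TopologicalSpace S] [DiscreteTopology S] :
    DeltaGeneratedSpace S := ⟨continuous_of_discreteTopology⟩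

/-- The `Δ`-kelleyfication of a topological space. -/
abbrev Kel (X : Type*) [TopologicalSpace X] : Type _ := 
  Topology.WithGeneratedByTopology (fun n ↦ Fin n → ℝ) X

/-- The identity map onto the `Δ`-kelleyfication. -/
abbrev toKel {X : Type*} [TopologicalSpace X] (x : X) : Kel X :=
  Topology.WithGeneratedByTopology.equiv.symm x

/-- The identity map from the `Δ`-kelleyfication. -/
abbrev ofKel {X : Type*} [TopologicalSpace X] (x : Kel X) : X :=
  Topology.WithGeneratedByTopology.equiv x

theorem continuous_toKel_comp {X Y : Type*} [TopologicalSpace X] [TopologicalSpace Y]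
    [DeltaGeneratedSpace Y] {f : Y → X} (hf : Continuous f) :
    Continuous (fun y => toKel (f y)) :=
  (Topology.IsGeneratedBy.equiv_symm_comp_continuous_iff (fun n ↦ Fin n → ℝ) f).2 hf

/-- Functoriality of the `Δ`-kelleyfication. -/
def kelMap {X Y : Type*} [TopologicalSpace X] [TopologicalSpace Y] (f : X → Y) (x : Kel X) :
    Kel Y := toKel (f (ofKel x))

theorem continuous_kelMap {X Y : Type*} [TopologicalSpace X] [TopologicalSpace Y] {f : X → Y}
    (hf : Continuous f) : Continuous (kelMap f) :=
  continuous_toKel_comp (hf.comp Topology.WithGeneratedByTopology.continuous_equiv)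

/-! ### Multipointed d-spaces -/

/-- A multipointed `d`-space. A path `[0,1] → |X|` is recorded together with its endpoints, so that
`exec x y` is the set of execution paths from `x` to `y`; `Path.trans` is the normalized
composition. -/
structure MDSpace where
  carrier : Type
  [top : TopologicalSpace carrier]
  [gen : DeltaGeneratedSpace carrier]
  states : Set carrier
  exec : ∀ x y : carrier, Set (Path x y)
  exec_states : ∀ {x y : carrier} {p : Path x y}, p ∈ exec x y → x ∈ states ∧ y ∈ states
  exec_reparam : ∀ {x y : carrier} {p : Path x y}, p ∈ exec x y →
    ∀ (φ : I → I), IsReparam φ → ∀ q : Path x y, (∀ t, q t = p (φ t)) → q ∈ exec x y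
  exec_trans : ∀ {x y z : carrier} {p : Path x y} {q : Path y z}, p ∈ exec x y → q ∈ exec y z →
    p.trans q ∈ exec x z

attribute [instance] MDSpace.top MDSpace.gen

namespace MDSpace

/-- Maps of multipointed `d`-spaces. -/
@[ext]
structure Hom (X Y : MDSpace) where
  map : C(X.carrier, Y.carrier)
  map_states : ∀ x ∈ X.states, map x ∈ Y.states
  map_exec : ∀ {x y : X.carrier} (p : Path x y), p ∈ X.exec x y →
    p.map map.continuous ∈ Y.exec (map x) (map y)

instance : Category MDSpace where
  Hom := Hom
  id X := { map := ContinuousMap.id _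
            map_states := fun _ h => h
            map_exec := fun _ h => h }
  comp f g := { map := g.map.comp f.map
                map_states := fun x h => g.map_states _ (f.map_states x h)
                map_exec := fun p h => g.map_exec _ (f.map_exec p h) }

/-- The multipointed `d`-space `(S, S, ∅)` associated with a set `S`. -/
def discrete (S : Type) : MDSpace :=
  letI : TopologicalSpace S := ⊥
  haveI : DiscreteTopology S := ⟨rfl⟩
  { carrier := S
    states := Set.univ
    exec := fun _ _ => ∅
    exec_states := fun h => h.elim
    exec_reparam := fun h => h.elim
    exec_trans := fun h => h.elim }

/-- The space `P^top_{x,y} X` of execution paths from `x` to `y`, with the `Δ`-kelleyfication of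
the (relative) compact-open topology. -/
abbrev ExecSpace (X : MDSpace) (x y : X.carrier) : Type := Kel (X.exec x y)

/-- The continuous map `P^top f : P^top_{x,y} X → P^top_{f x,f y} Y`. -/
def execMap {X Y : MDSpace} (f : X ⟶ Y) (x y : X.carrier) :
    C(X.ExecSpace x y, Y.ExecSpace (f.map x) (f.map y)) where
  toFun := kelMap fun p => ⟨p.1.map f.map.continuous, f.map_exec p.1 p.2⟩
  continuous_toFun := by
    refine continuous_kelMap (Continuous.subtype_mk ?_ _)
    refine continuous_induced_rng.2 ?_
    exact (ContinuousMap.continuous_postcomp f.map).comp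
      (continuous_induced_dom.comp continuous_subtype_val)

end MDSpace

/-! ### Globes -/

section Glob

variable (Z : Type) [TopologicalSpace Z]

/-- The identifications `(z,0) = 0` and `(z,1) = 1` (`false` stands for `0`, `true` for `1`). -/
inductive GlobRel : Bool ⊕ Kel (Z × I) → Bool ⊕ Kel (Z × I) → Prop
  | zero (z : Z) : GlobRel (Sum.inr (toKel (z, 0))) (Sum.inl false)
  | one (z : Z) : GlobRel (Sum.inr (toKel (z, 1))) (Sum.inl true)

/-- The underlying space of the globe of `Z`. -/
abbrev GlobCarrier : Type := Quot (GlobRel Z)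

variable {Z}

/-- The point `(z,t)` of the globe of `Z`. -/
def globPt (z : Z) (t : I) : GlobCarrier Z := Quot.mk _ (Sum.inr (toKel (z, t)))

/-- The states `0` and `1` of the globe of `Z`. -/
def globState (b : Bool) : GlobCarrier Z := Quot.mk _ (Sum.inl b)

theorem globPt_zero (z : Z) : globPt z 0 = globState false := Quot.sound (GlobRel.zero z)

theorem globPt_one (z : Z) : globPt z 1 = globState true := Quot.sound (GlobRel.one z)

theorem continuous_globPt (z : Z) : Continuous (globPt z) :=
  continuous_quot_mk.comp (continuous_inr.comp (continuous_toKel_comp (by fun_prop)))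

/-- The time coordinate on the globe. -/
def globTime : GlobCarrier Z → I :=
  Quot.lift (Sum.elim (fun b => if b then 1 else 0) fun p => (ofKel p).2) (by
    rintro _ _ (z | z) <;> simp)

theorem globState_ne : (globState true : GlobCarrier Z) ≠ globState false := by
  intro h
  have := congrArg globTime h
  simp [globTime, globState] at this

variable (Z)

/-- The topological globe `Glob^top(Z)`. -/
def glob : MDSpace where
  carrier := GlobCarrier Z
  states := Set.range globState
  exec x y := {p | ∃ (z : Z) (φ : I → I), IsReparam φ ∧ ∀ t, p t = globPt z (φ t)}
  exec_states := by
    rintro x y p ⟨z, φ, hφ, h⟩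
    exact ⟨⟨false, by rw [← p.source, h, hφ.zero, globPt_zero]⟩,
      ⟨true, by rw [← p.target, h, hφ.one, globPt_one]⟩⟩
  exec_reparam := by
    rintro x y p ⟨z, φ, hφ, h⟩ ψ hψ q hq
    exact ⟨z, fun t => φ (ψ t), hφ.comp hψ, fun t => by rw [hq, h]⟩
  exec_trans := by
    rintro x y w p q ⟨z, φ, hφ, h⟩ ⟨z', φ', hφ', h'⟩
    refine absurd ?_ (globState_ne (Z := Z))
    rw [← globPt_one z, ← hφ.one, ← h, p.target, ← q.source, h', hφ'.zero, globPt_zero]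

variable {Z}

/-- The map of globes induced by a continuous map. -/
def globMap {Z' : Type} [TopologicalSpace Z'] (g : C(Z, Z')) : glob Z ⟶ glob Z' where
  map :=
    { toFun := Quot.map (Sum.map id (kelMap (Prod.map g id))) (by
        rintro _ _ (z | z)
        · exact GlobRel.zero (g z)
        · exact GlobRel.one (g z))
      continuous_toFun := by
        refine continuous_quot_lift _ (continuous_quot_mk.comp ?_)
        exact continuous_id.sumMap (continuous_kelMap (by fun_prop)) }
  map_states := by
    rintro _ ⟨b, rfl⟩
    exact ⟨b, rfl⟩
  map_exec := by
    rintro x y p ⟨z, φ, hφ, h⟩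
    refine ⟨g z, φ, hφ, fun t => ?_⟩
    exact (congrArg _ (h t)).trans rfl

end Glob

/-- The sphere `S^{n-1}`, which is empty for `n = 0`. -/
abbrev Sph (n : ℕ) : Type := Metric.sphere (0 : EuclideanSpace ℝ (Fin n)) 1

/-- The disk `D^n`. -/
abbrev Disk (n : ℕ) : Type := Metric.closedBall (0 : EuclideanSpace ℝ (Fin n)) 1

/-- The map `Glob^top(S^{n-1}) → Glob^top(D^n)` induced by the inclusion. -/
def globIncl (n : ℕ) : glob (Sph n) ⟶ glob (Disk n) :=
  globMap ⟨Set.inclusion Metric.sphere_subset_closedBall, continuous_inclusion _⟩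

/-! ### Cellular multipointed d-spaces -/

/-- `X` is cellular: it is the colimit of a colimit-preserving transfinite sequence which starts
from a set (with no execution paths) and of which each step is a pushout along
`Glob^top(S^{n-1}) → Glob^top(D^n)` for some `n ≥ 0`. The well-ordered index set `J` is the
ordinal. -/
def MDSpace.IsCellular (X : MDSpace) : Prop :=
  ∃ (S : Type) (i : MDSpace.discrete S ⟶ X)
    (J : Type) (_ : LinearOrder J) (_ : OrderBot J) (_ : SuccOrder J) (_ : WellFoundedLT J)
    (c : TransfiniteCompositionOfShape J i),
    ∀ j : J, ¬ IsMax j →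
      ∃ (n : ℕ) (g : glob (Sph n) ⟶ c.F.obj j) (g' : glob (Disk n) ⟶ c.F.obj (Order.succ j)),
        IsPushout g (globIncl n) (c.F.map (homOfLE (Order.le_succ j))) g'

/-! ### Weak homotopy equivalences, Serre fibrations, the q-model structure -/

/-- The map induced on path components. -/
def zerothMap {X Y : Type*} [TopologicalSpace X] [TopologicalSpace Y] (f : C(X, Y)) :
    ZerothHomotopy X → ZerothHomotopy Y :=
  Quotient.map f fun _ _ h => h.map f.continuous

/-- The map `π_n(X,x) → π_n(Y,f x)`. -/
def piMap {X Y : Type*} [TopologicalSpace X] [TopologicalSpace Y] (f : C(X, Y)) (n : ℕ) (x : X) :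
    HomotopyGroup.Pi n X x → HomotopyGroup.Pi n Y (f x) :=
  Quotient.map (fun γ : GenLoop (Fin n) X x =>
      (⟨f.comp γ.1, fun y hy => congrArg f (γ.2 y hy)⟩ : GenLoop (Fin n) Y (f x)))
    fun _ _ h => ⟨h.some.compContinuousMap f⟩

/-- Weak homotopy equivalences of topological spaces. -/
def IsWeakHomotopyEquiv {X Y : Type*} [TopologicalSpace X] [TopologicalSpace Y] (f : C(X, Y)) :
    Prop :=
  Function.Bijective (zerothMap f) ∧
    ∀ (n : ℕ), 1 ≤ n → ∀ x : X, Function.Bijective (piMap f n x)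

/-- q-fibrations of topological spaces, i.e. Serre fibrations: the homotopy lifting property with
respect to all cubes. -/
def IsSerreFibration {X Y : Type*} [TopologicalSpace X] [TopologicalSpace Y] (f : C(X, Y)) :
    Prop :=
  ∀ (n : ℕ) (h : C((Fin n → I), X)) (H : C((Fin n → I) × I, Y)),
    (∀ s, H (s, 0) = f (h s)) →
      ∃ K : C((Fin n → I) × I, X), (∀ s, K (s, 0) = h s) ∧ ∀ s, f (K s) = H s

/-- The weak equivalences of the q-model structure: bijections on states inducing a weak homotopy
equivalence `P^top f`, where `P^top X` is the disjoint sum of the spaces `P^top_{x,y} X`. -/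
def IsQWeakEquiv {X Y : MDSpace} (f : X ⟶ Y) : Prop :=
  Set.BijOn f.map X.states Y.states ∧
    ∀ x ∈ X.states, ∀ y ∈ X.states, IsWeakHomotopyEquiv (MDSpace.execMap f x y)

/-- The fibrations of the q-model structure: `P^top f` is a q-fibration of spaces (cubes being
connected, this can be tested on the summands `P^top_{x,y} X`). -/
def IsQFibration {X Y : MDSpace} (f : X ⟶ Y) : Prop :=
  ∀ x ∈ X.states, ∀ y ∈ X.states, IsSerreFibration (MDSpace.execMap f x y)

/-- Trivial q-fibrations. -/
def IsTrivialQFibration {X Y : MDSpace} (f : X ⟶ Y) : Prop := IsQFibration f ∧ IsQWeakEquiv f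

/-! ### Directed spaces -/

/-- A directed space; `dpath x y` is the set of directed paths from `x` to `y`. -/
structure DirSpace where
  carrier : Type
  [top : TopologicalSpace carrier]
  [gen : DeltaGeneratedSpace carrier]
  dpath : ∀ x y : carrier, Set (Path x y)
  dpath_refl : ∀ x, Path.refl x ∈ dpath x x
  dpath_trans : ∀ {x y z : carrier} {p : Path x y} {q : Path y z},
    p ∈ dpath x y → q ∈ dpath y z → p.trans q ∈ dpath x z
  dpath_reparam : ∀ {x y x' y' : carrier} {p : Path x y}, p ∈ dpath x y →
    ∀ (φ : I → I), Monotone φ → Continuous φ →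
      ∀ q : Path x' y', (∀ t, q t = p (φ t)) → q ∈ dpath x' y'

attribute [instance] DirSpace.top DirSpace.gen

/-- Morphisms of directed spaces. -/
structure DirSpace.Hom (X Y : DirSpace) where
  map : C(X.carrier, Y.carrier)
  map_dpath : ∀ {x y : X.carrier} (p : Path x y), p ∈ X.dpath x y →
    p.map map.continuous ∈ Y.dpath (map x) (map y)

/-- `MooreChain X γ a b` says that the restriction of `γ` to `[a,b]`, `a < b`, is a finite Moore
composition of paths of the form `e φ`, where `e` is an execution path of `X` and where `φ` is
non-decreasing and continuous. -/
inductive MooreChain (X : MDSpace) (γ : I → X.carrier) : I → I → Prop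
  | piece {a b : I} (hab : a < b) {x y : X.carrier} (e : Path x y) (he : e ∈ X.exec x y)
      (φ : I → I) (hm : Monotone φ) (hc : Continuous φ)
      (h : ∀ t ∈ Set.Icc a b, γ t = e (φ t)) : MooreChain X γ a b
  | comp {a b c : I} : MooreChain X γ a b → MooreChain X γ b c → MooreChain X γ a c

theorem MooreChain.lt {X : MDSpace} {γ : I → X.carrier} {a b : I} (h : MooreChain X γ a b) :
    a < b := by
  induction h with
  | piece hab => exact hab
  | comp _ _ h1 h2 => exact h1.trans h2

theorem MooreChain.left {X : MDSpace} {γ : I → X.carrier} {a b : I} (h : MooreChain X γ a b) :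
    ∃ (x y : X.carrier) (e : Path x y) (_ : e ∈ X.exec x y) (s : I), γ a = e s := by
  induction h with
  | piece hab e he φ hm hc h => exact ⟨_, _, e, he, _, h _ ⟨le_rfl, hab.le⟩⟩
  | comp _ _ h1 _ => exact h1

theorem MooreChain.right {X : MDSpace} {γ : I → X.carrier} {a b : I} (h : MooreChain X γ a b) :
    ∃ (x y : X.carrier) (e : Path x y) (_ : e ∈ X.exec x y) (s : I), γ b = e s := by
  induction h with
  | piece hab e he φ hm hc h => exact ⟨_, _, e, he, _, h _ ⟨hab.le, le_rfl⟩⟩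
  | comp _ _ _ h2 => exact h2

theorem MooreChain.const {X : MDSpace} {γ : I → X.carrier} {a b : I} (hab : a < b)
    {x y : X.carrier} (e : Path x y) (he : e ∈ X.exec x y) (s : I)
    (h : ∀ t ∈ Set.Icc a b, γ t = e s) : MooreChain X γ a b :=
  .piece hab e he (fun _ => s) monotone_const continuous_const h

theorem MooreChain.reparam {X : MDSpace} {γ γ' : I → X.carrier} {a b : I}
    (h : MooreChain X γ a b) {ρ : I → I} (hm : Monotone ρ) (hc : Continuous ρ) {c d : I}
    (hcd : c < d) (hac : a ≤ ρ c) (hdb : ρ d ≤ b) (h' : ∀ t ∈ Set.Icc c d, γ' t = γ (ρ t)) :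
    MooreChain X γ' c d := by
  induction h generalizing c d with
  | piece hab e he φ hm' hc' h =>
    refine .piece hcd e he (fun t => φ (ρ t)) (hm'.comp hm) (hc'.comp hc) fun t ht => ?_
    rw [h' t ht, h _ ⟨hac.trans (hm ht.1), (hm ht.2).trans hdb⟩]
  | @comp a m b _ _ ih1 ih2 =>
    rcases le_or_gt (ρ d) m with h1 | h1
    · exact ih1 hcd hac h1 h'
    rcases le_or_gt m (ρ c) with h2 | h2
    · exact ih2 hcd h2 hdb h'
    obtain ⟨s, hs, rfl⟩ := intermediate_value_Icc hcd.le hc.continuousOn ⟨h2.le, h1.le⟩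
    have hcs : c < s := lt_of_le_of_ne hs.1 fun h => h2.ne (h ▸ rfl)
    have hsd : s < d := lt_of_le_of_ne hs.2 fun h => h1.ne (h ▸ rfl)
    exact .comp (ih1 hcs hac le_rfl fun t ht => h' t ⟨ht.1, ht.2.trans hs.2⟩)
      (ih2 hsd le_rfl hdb fun t ht => h' t ⟨hs.1.trans ht.1, ht.2⟩)

theorem MooreChain.map {X Y : MDSpace} (f : X ⟶ Y) {γ : I → X.carrier} {a b : I}
    (h : MooreChain X γ a b) : MooreChain Y (fun t => f.map (γ t)) a b := by
  induction h with
  | piece hab e he φ hm hc h =>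
    exact .piece hab _ (f.map_exec e he) φ hm hc fun t ht => by simp [h t ht]
  | comp _ _ h1 h2 => exact .comp h1 h2

/-- Directed paths of a multipointed `d`-space: constant paths, and finite Moore compositions of
paths `e φ` with `e` an execution path and `φ` non-decreasing and continuous. -/
def IsDirectedPath (X : MDSpace) {x y : X.carrier} (γ : Path x y) : Prop :=
  (∀ t, γ t = x) ∨ MooreChain X γ 0 1

theorem half_mem_I : (1 / 2 : ℝ) ∈ I := by constructor <;> norm_num

theorem dblL_half : dblL ⟨1 / 2, half_mem_I⟩ = 1 := by
  unfold dblL; norm_num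

theorem dblR_half : dblR ⟨1 / 2, half_mem_I⟩ = 0 := by
  unfold dblR; norm_num

theorem isDirectedPath_trans (X : MDSpace) {x y z : X.carrier} {p : Path x y} {q : Path y z}
    (hp : IsDirectedPath X p) (hq : IsDirectedPath X q) : IsDirectedPath X (p.trans q) := by
  have h0 : (0 : I) < ⟨1 / 2, half_mem_I⟩ := Subtype.mk_lt_mk.2 (by norm_num)
  have h1 : (⟨1 / 2, half_mem_I⟩ : I) < 1 := Subtype.mk_lt_mk.2 (by norm_num)
  have hL : ∀ t ∈ Set.Icc (0 : I) ⟨1 / 2, half_mem_I⟩, p.trans q t = p (dblL t) :=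
    fun t ht => trans_eq_left p q ht.2
  have hR : ∀ t ∈ Set.Icc (⟨1 / 2, half_mem_I⟩ : I) 1, p.trans q t = q (dblR t) :=
    fun t ht => trans_eq_right p q ht.1
  have cL : MooreChain X p 0 1 → MooreChain X (p.trans q) 0 ⟨1 / 2, half_mem_I⟩ := fun h =>
    h.reparam dblL_mono dblL_continuous h0 (dblL 0).2.1 (dblL _).2.2 hL
  have cR : MooreChain X q 0 1 → MooreChain X (p.trans q) ⟨1 / 2, half_mem_I⟩ 1 := fun h =>
    h.reparam dblR_mono dblR_continuous h1 (dblR _).2.1 (dblR 1).2.2 hR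
  rcases hp with hp | hp <;> rcases hq with hq | hq
  · left
    have hxy : y = x := by rw [← p.target, hp]
    intro t
    rcases le_total (t : ℝ) (1 / 2) with ht | ht
    · rw [trans_eq_left p q ht, hp]
    · rw [trans_eq_right p q ht, hq, hxy]
  · right
    obtain ⟨_, _, e, he, s, hs⟩ := hq.left
    have hxy : y = x := by rw [← p.target, hp]
    refine .comp (.const h0 e he s fun t ht => ?_) (cR hq)
    rw [hL t ht, hp, ← hs, q.source, hxy]
  · right
    obtain ⟨_, _, e, he, s, hs⟩ := hp.right
    refine .comp (cL hp) (.const h1 e he s fun t ht => ?_)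
    rw [hR t ht, hq, ← hs, p.target]
  · exact .inr (.comp (cL hp) (cR hq))

theorem isDirectedPath_reparam (X : MDSpace) {x y x' y' : X.carrier} {p : Path x y}
    (hp : IsDirectedPath X p) (φ : I → I) (hm : Monotone φ) (hc : Continuous φ)
    (q : Path x' y') (hq : ∀ t, q t = p (φ t)) : IsDirectedPath X q := by
  rcases hp with hp | hp
  · left
    intro t
    rw [hq, hp, ← q.source, hq, hp]
  · exact .inr (hp.reparam hm hc zero_lt_one (φ 0).2.1 (φ 1).2.2 fun t _ => hq t)

/-- The directed space associated with a multipointed `d`-space. -/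
def sp (X : MDSpace) : DirSpace where
  carrier := X.carrier
  dpath _ _ := {γ | IsDirectedPath X γ}
  dpath_refl _ := Or.inl fun _ => rfl
  dpath_trans hp hq := isDirectedPath_trans X hp hq
  dpath_reparam hp φ hm hc q hq := isDirectedPath_reparam X hp φ hm hc q hq

/-- Functoriality of `sp`. -/
def spMap {X Y : MDSpace} (f : X ⟶ Y) : DirSpace.Hom (sp X) (sp Y) where
  map := f.map
  map_dpath p hp := by
    rcases hp with hp | hp
    · exact .inl fun t => congrArg f.map (hp t)
    · exact .inr (hp.map f)

/-! ### Traces -/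

section Trace

variable (X : DirSpace)

/-- The space of directed paths from `x` to `y`, with the `Δ`-kelleyfication of the compact-open
topology. -/
abbrev DPathSpace (x y : X.carrier) : Type := Kel (X.dpath x y)

/-- The identifications `γ ∼ γ φ` with `φ ∈ M(1,1)`. -/
def traceRel (x y : X.carrier) (p q : DPathSpace X x y) : Prop :=
  ∃ φ : I → I, IsReparam φ ∧ ∀ t, (ofKel q).1 t = (ofKel p).1 (φ t)

/-- The space of traces from `x` to `y`, with the quotient topology. -/
abbrev Trace (x y : X.carrier) : Type := Quot (traceRel X x y)

variable {X}

/-- The trace of a directed path. -/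
def Trace.mk {x y : X.carrier} (p : Path x y) (hp : p ∈ X.dpath x y) : Trace X x y :=
  Quot.mk _ (toKel ⟨p, hp⟩)

theorem Trace.sound {x y : X.carrier} {p q : Path x y} (hp : p ∈ X.dpath x y)
    (hq : q ∈ X.dpath x y) (φ : I → I) (hφ : IsReparam φ) (h : ∀ t, q t = p (φ t)) :
    Trace.mk p hp = Trace.mk q hq :=
  Quot.sound ⟨φ, hφ, h⟩

/-- Composition of directed paths. -/
def dpathComp {x y z : X.carrier} (p : DPathSpace X x y) (q : DPathSpace X y z) :
    DPathSpace X x z :=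
  toKel ⟨(ofKel p).1.trans (ofKel q).1, X.dpath_trans (ofKel p).2 (ofKel q).2⟩

/-- Composition of traces. -/
def Trace.comp {x y z : X.carrier} : Trace X x y → Trace X y z → Trace X x z :=
  Quot.map₂ dpathComp
    (fun p _ _ h => ⟨_, tensor_isReparam IsReparam.id h.choose_spec.1,
      trans_tensor (p := (ofKel p).1) (fun _ => rfl) h.choose_spec.2⟩)
    (fun _ _ q h => ⟨_, tensor_isReparam h.choose_spec.1 IsReparam.id,
      trans_tensor (q := (ofKel q).1) h.choose_spec.2 fun _ => rfl⟩)

theorem Trace.mk_comp {x y z : X.carrier} (p : Path x y) (hp : p ∈ X.dpath x y) (q : Path y z)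
    (hq : q ∈ X.dpath y z) :
    (Trace.mk p hp).comp (Trace.mk q hq) = Trace.mk (p.trans q) (X.dpath_trans hp hq) := rfl

theorem Trace.exists_mk {x y : X.carrier} (τ : Trace X x y) :
    ∃ (p : Path x y) (hp : p ∈ X.dpath x y), τ = Trace.mk p hp := by
  obtain ⟨p, rfl⟩ := Quot.exists_rep τ
  exact ⟨(ofKel p).1, (ofKel p).2, rfl⟩

theorem dblR_isReparam : IsReparam dblR :=
  .of dblR_mono dblR_continuous (by unfold dblR; simp [Set.projIcc_of_le_left])
    (by unfold dblR; norm_num)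

theorem dblL_isReparam : IsReparam dblL :=
  .of dblL_mono dblL_continuous (by unfold dblL; norm_num)
    (by unfold dblL; exact Set.projIcc_of_right_le _ (by norm_num))

theorem Trace.refl_comp {x y : X.carrier} (τ : Trace X x y) :
    (Trace.mk (Path.refl x) (X.dpath_refl x)).comp τ = τ := by
  obtain ⟨p, hp, rfl⟩ := τ.exists_mk
  rw [mk_comp]
  refine (Trace.sound _ _ dblR dblR_isReparam fun t => ?_).symm
  rcases le_total (t : ℝ) (1 / 2) with h | h
  · rw [trans_eq_left _ _ h]
    have : dblR t = 0 := Set.projIcc_of_le_left _ (by linarith)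
    rw [this, p.source]; rfl
  · rw [trans_eq_right _ _ h]

theorem Trace.comp_refl {x y : X.carrier} (τ : Trace X x y) :
    τ.comp (Trace.mk (Path.refl y) (X.dpath_refl y)) = τ := by
  obtain ⟨p, hp, rfl⟩ := τ.exists_mk
  rw [mk_comp]
  refine (Trace.sound _ _ dblL dblL_isReparam fun t => ?_).symm
  rcases le_total (t : ℝ) (1 / 2) with h | h
  · rw [trans_eq_left _ _ h]
  · rw [trans_eq_right _ _ h]
    have : dblL t = 1 := Set.projIcc_of_right_le _ (by linarith)
    rw [this, p.target]; rfl

theorem Trace.assoc {x y z w : X.carrier} (τ : Trace X x y) (τ' : Trace X y z)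
    (τ'' : Trace X z w) : (τ.comp τ').comp τ'' = τ.comp (τ'.comp τ'') := by
  obtain ⟨p, hp, rfl⟩ := τ.exists_mk
  obtain ⟨q, hq, rfl⟩ := τ'.exists_mk
  obtain ⟨r, hr, rfl⟩ := τ''.exists_mk
  simp only [mk_comp]
  refine (Trace.sound _ _ (fun t => ⟨Path.Homotopy.transAssocReparamAux t,
    Path.Homotopy.transAssocReparamAux_mem_I t⟩) (.of ?_ ?_ ?_ ?_) fun t => ?_).symm
  · intro a b hab
    have hab' : (a : ℝ) ≤ b := hab
    refine Subtype.mk_le_mk.2 ?_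
    unfold Path.Homotopy.transAssocReparamAux
    split_ifs <;> linarith
  · exact Path.Homotopy.continuous_transAssocReparamAux.subtype_mk _
  · exact Subtype.ext Path.Homotopy.transAssocReparamAux_zero
  · exact Subtype.ext Path.Homotopy.transAssocReparamAux_one
  · rw [Path.Homotopy.trans_assoc_reparam]; rfl

variable (X)

/-- The category of traces of a directed space: its objects are the points and its morphisms are
the traces. -/
structure TraceCat where
  pt : X.carrier

instance : SmallCategory (TraceCat X) where
  Hom x y := Trace X x.pt y.pt
  id x := Trace.mk (Path.refl x.pt) (X.dpath_refl x.pt)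
  comp f g := Trace.comp f g
  id_comp f := Trace.refl_comp f
  comp_id f := Trace.comp_refl f
  assoc f g h := Trace.assoc f g h

variable {X} {Y : DirSpace}

/-- The map induced on traces by a morphism of directed spaces. -/
def traceMap (f : DirSpace.Hom X Y) (x y : X.carrier) : Trace X x y → Trace Y (f.map x) (f.map y) :=
  Quot.map (kelMap fun p => ⟨p.1.map f.map.continuous, f.map_dpath p.1 p.2⟩)
    fun _ _ ⟨φ, hφ, h⟩ => ⟨φ, hφ, fun t => congrArg f.map (h t)⟩

theorem continuous_traceMap (f : DirSpace.Hom X Y) (x y : X.carrier) :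
    Continuous (traceMap f x y) := by
  refine continuous_quot_lift _ (continuous_quot_mk.comp ?_)
  refine continuous_kelMap (Continuous.subtype_mk ?_ _)
  refine continuous_induced_rng.2 ?_
  exact (ContinuousMap.continuous_postcomp f.map).comp
    (continuous_induced_dom.comp continuous_subtype_val)

theorem traceMap_mk (f : DirSpace.Hom X Y) {x y : X.carrier} (p : Path x y)
    (hp : p ∈ X.dpath x y) :
    traceMap f x y (Trace.mk p hp) = Trace.mk (p.map f.map.continuous) (f.map_dpath p hp) := rfl

theorem traceMap_comp (f : DirSpace.Hom X Y) {x y z : X.carrier} (τ : Trace X x y)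
    (τ' : Trace X y z) :
    traceMap f x z (τ.comp τ') = (traceMap f x y τ).comp (traceMap f y z τ') := by
  obtain ⟨p, hp, rfl⟩ := τ.exists_mk
  obtain ⟨q, hq, rfl⟩ := τ'.exists_mk
  rw [Trace.mk_comp, traceMap_mk, traceMap_mk, traceMap_mk, Trace.mk_comp]
  refine Trace.sound _ _ _ IsReparam.id fun t => ?_
  rw [Path.map_trans]

/-- The functor induced on the categories of traces by a morphism of directed spaces. -/
def traceFunctor (f : DirSpace.Hom X Y) : TraceCat X ⥤ TraceCat Y where
  obj x := ⟨f.map x.pt⟩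
  map {x y} ξ := traceMap f x.pt y.pt ξ
  map_id _ := Trace.sound _ _ _ IsReparam.id fun _ => rfl
  map_comp ξ ξ' := traceMap_comp f ξ ξ'

/-- The extension map `ξ ↦ α * ξ * β` on spaces of traces. -/
def traceExtend {x y x' y' : X.carrier} (α : Trace X x' x) (β : Trace X y y') :
    C(Trace X x y, Trace X x' y') where
  toFun ξ := (α.comp ξ).comp β
  continuous_toFun := by
    obtain ⟨p, hp, rfl⟩ := α.exists_mk
    obtain ⟨q, hq, rfl⟩ := β.exists_mk
    have h1 : Continuous fun r : X.dpath x y => p.trans r.1 :=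
      Path.continuous_trans.comp (continuous_const.prodMk continuous_subtype_val)
    have h2 : Continuous fun r : X.dpath x y => (⟨(p.trans r.1).trans q,
        X.dpath_trans (X.dpath_trans hp r.2) hq⟩ : X.dpath x' y') :=
      Continuous.subtype_mk (Path.continuous_trans.comp (h1.prodMk continuous_const)) _
    refine isQuotientMap_quot_mk.continuous_iff.2 ?_
    exact continuous_quot_mk.comp (continuous_kelMap h2)

end Trace

/-! ### Categories of factorizations, diagrams, open maps -/

/-- The category of factorizations of `C`: its objects are the morphisms of `C`. -/
structure FactCat (C : Type) [SmallCategory C] where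
  src : C
  tgt : C
  hom : src ⟶ tgt

/-- Extensions of morphisms. -/
@[ext]
structure FactCat.Hom {C : Type} [SmallCategory C] (f f' : FactCat C) where
  u : f'.src ⟶ f.src
  v : f.tgt ⟶ f'.tgt
  w : (u ≫ f.hom) ≫ v = f'.hom

instance (C : Type) [SmallCategory C] : SmallCategory (FactCat C) where
  Hom := FactCat.Hom
  id f := ⟨𝟙 _, 𝟙 _, by simp⟩
  comp a b := ⟨b.u ≫ a.u, a.v ≫ b.v, by rw [← b.w, ← a.w]; simp⟩
  id_comp a := FactCat.Hom.ext (Category.comp_id _) (Category.id_comp _)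
  comp_id a := FactCat.Hom.ext (Category.id_comp _) (Category.comp_id _)
  assoc a b c := FactCat.Hom.ext (Category.assoc _ _ _).symm (Category.assoc _ _ _)

/-- The functor between categories of factorizations induced by a functor. -/
def factMap {C D : Type} [SmallCategory C] [SmallCategory D] (F : C ⥤ D) :
    FactCat C ⥤ FactCat D where
  obj f := ⟨F.obj f.src, F.obj f.tgt, F.map f.hom⟩
  map a := ⟨F.map a.u, F.map a.v, by rw [← F.map_comp, ← F.map_comp, a.w]⟩
  map_id f := FactCat.Hom.ext (F.map_id _) (F.map_id _)
  map_comp a b := FactCat.Hom.ext (F.map_comp _ _) (F.map_comp _ _)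

universe v u

/-- Small diagrams in `K`, over varying small categories. -/
structure Diag (K : Type u) [Category.{v} K] where
  index : Type
  [cat : SmallCategory index]
  functor : index ⥤ K

attribute [instance] Diag.cat

/-- Morphisms of diagrams. -/
structure Diag.Hom {K : Type u} [Category.{v} K] (F G : Diag K) where
  base : F.index ⥤ G.index
  nat : F.functor ⟶ base ⋙ G.functor

/-- The diagram `H.F`. -/
def Diag.comp {K : Type u} [Category.{v} K] (F : Diag K) {L : Type*} [Category L]
    (H : K ⥤ L) : Diag L := ⟨F.index, F.functor ⋙ H⟩

/-- The map of diagrams `(f, H.μ) : H.F → H.G`. -/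
def Diag.Hom.comp {K : Type u} [Category.{v} K] {F G : Diag K} (φ : Diag.Hom F G) {L : Type*}
    [Category L] (H : K ⥤ L) : Diag.Hom (F.comp H) (G.comp H) where
  base := φ.base
  nat := Functor.whiskerRight φ.nat H

/-- Open maps of diagrams. -/
def Diag.Hom.IsOpen {K : Type u} [Category.{v} K] {F G : Diag K} (φ : Diag.Hom F G) : Prop :=
  Function.Surjective φ.base.obj ∧
    (∀ (i : F.index) (j' : G.index) (g : φ.base.obj i ⟶ j'),
      ∃ (j : F.index) (h : i ⟶ j) (e : φ.base.obj j = j'), φ.base.map h ≫ eqToHom e = g) ∧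
    IsIso φ.nat

/-- The weak homotopy equivalences of delta-generated spaces. -/
def weakEquivalences : MorphismProperty DeltaGenerated.{0} :=
  fun _ _ f => IsWeakHomotopyEquiv (DeltaGenerated.deltaGeneratedToTop.map f).hom

/-- The homotopy category of (delta-generated) spaces. -/
abbrev Ho : Type 1 := weakEquivalences.Localization

/-- The canonical functor to the homotopy category. -/
abbrev toHo : DeltaGenerated.{0} ⥤ Ho := weakEquivalences.Q

/-- Maps of diagrams of spaces which are open up to homotopy. -/
def Diag.Hom.IsOpenUpToHomotopy {F G : Diag DeltaGenerated.{0}} (φ : Diag.Hom F G) : Prop :=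
  (φ.comp toHo).IsOpen

/-! ### The natural system of a multipointed d-space -/

/-- The natural system of a directed space: it takes the trace of a path `γ` to the space of traces
from `γ(0)` to `γ(1)`, and an extension to the composition with the two extending traces. -/
def ntDir (X : DirSpace) : Diag DeltaGenerated.{0} where
  index := FactCat (TraceCat X)
  functor :=
    { obj := fun f => DeltaGenerated.of (Trace X f.src.pt f.tgt.pt)
      map := fun {f f'} a => ObjectProperty.homMk (TopCat.ofHom (traceExtend a.u a.v))
      map_id := fun f => by
        ext ξ
        exact (Trace.comp_refl _).trans (Trace.refl_comp _)
      map_comp := fun {f f' f''} a b => by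
        ext ξ
        change (Trace.comp (Trace.comp b.u a.u) ξ).comp (Trace.comp a.v b.v) =
          (Trace.comp b.u ((Trace.comp a.u ξ).comp a.v)).comp b.v
        simp only [Trace.assoc] }

/-- The map of natural systems induced by a map of directed spaces. -/
def ntDirMap {X Y : DirSpace} (f : DirSpace.Hom X Y) : Diag.Hom (ntDir X) (ntDir Y) where
  base := factMap (traceFunctor f)
  nat :=
    { app := fun ξ => ObjectProperty.homMk (TopCat.ofHom
        ⟨traceMap f ξ.src.pt ξ.tgt.pt, continuous_traceMap f _ _⟩)
      naturality := fun ξ ξ' a => by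
        ext ζ
        exact (traceMap_comp f _ _).trans (congrArg (Trace.comp · _) (traceMap_comp f _ _)) }

/-- The natural system of a multipointed `d`-space. -/
def nt (X : MDSpace) : Diag DeltaGenerated.{0} := ntDir (sp X)

/-- The map of natural systems induced by a map of multipointed `d`-spaces. -/
def ntMap {X Y : MDSpace} (f : X ⟶ Y) : Diag.Hom (nt X) (nt Y) := ntDirMap (spMap f)

/-! ### Realizations of 1-dimensional precubical sets -/

/-- A precubical set with no `n`-cubes for `n ≥ 2`: a set of vertices, a set of edges, and the two
face maps (initial and final vertex). -/
structure PrecubicalSet₁ where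
  V : Type
  E : Type
  src : E → V
  tgt : E → V

/-- `B`, with the given vertices and edges, is the tame realization of `K`: the multipointed
`d`-space freely generated by a state for each vertex and by an execution path for each edge (i.e.
the colimit of a point for each vertex and of a directed segment for each edge). -/
structure TameRealization (K : PrecubicalSet₁) (B : MDSpace) where
  vert : K.V → B.carrier
  vert_mem : ∀ v, vert v ∈ B.states
  edge : ∀ e, Path (vert (K.src e)) (vert (K.tgt e))
  edge_mem : ∀ e, edge e ∈ B.exec _ _
  universal : ∀ (Y : MDSpace) (v : K.V → Y.carrier), (∀ a, v a ∈ Y.states) →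
    ∀ p : ∀ e, Path (v (K.src e)) (v (K.tgt e)), (∀ e, p e ∈ Y.exec _ _) →
      ∃! h : B ⟶ Y, (∀ a, h.map (vert a) = v a) ∧ ∀ e t, h.map (edge e t) = p e t

/-- The loop-free precubical set with vertices `0, 1, 2, 3` and with edges `d₁ : 0 → 1`,
`d₂ : 1 → 2`, `d₃ : 2 → 3`, `d₄ : 1 → 2` (indexed by `0, 1, 2, 3` in this order). -/
def exampleSet : PrecubicalSet₁ where
  V := Fin 4
  E := Fin 4
  src := ![0, 1, 2, 1]
  tgt := ![1, 2, 3, 2]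

/-- The normalized composition `d₁ *_N d₂ *_N d₃` in a realization of `exampleSet`. -/
def longPath {B : MDSpace} (r : TameRealization exampleSet B) :
    Path (r.vert (0 : Fin 4)) (r.vert (3 : Fin 4)) :=
  Path.trans (Path.trans (r.edge (0 : Fin 4)) (r.edge (1 : Fin 4))) (r.edge (2 : Fin 4))

end DAT

end

/-!
The collapse `f : A → B` of the added globe `Glob([0,1])` onto the execution path
`d₁ *_N d₂ *_N d₃` does not change the execution paths up to homotopy, but it does change the
directed paths between points which are not states.

*Execution paths.* An execution path of `A` either lies in `B`, or is `t ↦ (z, φ(t))` for some `z`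
in `[0,1]` and some `φ` in `M(1,1)` (`exA_exec`). An execution path of `B` from `0` to `3` runs
either through `d₂` or through `d₄`, and which of the two is a locally constant function of the
path. The space of execution paths of `A` from `0` to `3` is therefore `[0,1] × M(1,1)` over those
which run through `d₂`, it is unchanged over those which run through `d₄`, and nothing changes
between the other states. So `P^top f` is a trivial fibration by a criterion which applies to all
maps of which each fibre is continuously a retract of the interval (`IntervalFibration`).

*Traces.* A directed path of `A` which starts at an inner point `(1,u)` of the globe can only move
along `t ↦ (1,t)` until it reaches the final state (`exPt_one_of_mooreChain`), because the
execution paths other than the `t ↦ (1, φ(t))` do not meet these inner points. Hence there is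
exactly one trace from `(1,u)` to `(1,v)`, if `0 < u < v < 1`. But if `(1,u)` projects to `d₁` and
`(1,v)` to `d₃`, then there are two traces between the images, one through `d₂` and one through
`d₄`, and a continuous function separates them (`card_zerothHomotopy_trace_exB`). Since the functor
of path components factors through `Ho(Top)`, the component of `NT(f)` at this trace is not an isomorphism
in `Ho(Top)`.

Two real-valued functions carry the analysis of `B`: the height `exHeight`, which is
non-decreasing along directed paths and for which `d₁ *_N d₂ *_N d₃` has height `t` at time `t`,
and `exSide`, which is negative inside `d₂`, positive inside `d₄`, and zero elsewhere. A path of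
non-decreasing height stays on one side (`exSide_nonpos_or_nonneg`) and is then determined by its
height.

Cellularity is finite: `B` is obtained from four states by attaching four copies of `Glob(D⁰)`, and
`A` from `B` by attaching a copy of `Glob(D⁰)`, which becomes the free end `t ↦ (1,t)`, and then a
copy of `Glob(D¹)`.
-/

noncomputable section

namespace DAT

/-! ### Multipointed d-spaces generated by a set of paths -/

theorem MDSpace.exec_congr (X : MDSpace) {x y x' y' : X.carrier} {p : Path x y}
    {q : Path x' y'} (hp : p ∈ X.exec x y) (h : ∀ t, q t = p t) : q ∈ X.exec x' y' := by
  obtain rfl : x' = x := by rw [← q.source, h, p.source]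
  obtain rfl : y' = y := by rw [← q.target, h, p.target]
  exact X.exec_reparam hp _ IsReparam.id q h

theorem MDSpace.comp_map {X Y Z : MDSpace} (f : X ⟶ Y) (g : Y ⟶ Z) (x : X.carrier) :
    (f ≫ g).map x = g.map (f.map x) := rfl

theorem MDSpace.hom_ext {X Y : MDSpace} {f g : X ⟶ Y} (h : ∀ x, f.map x = g.map x) : f = g :=
  MDSpace.Hom.ext (ContinuousMap.ext h)

theorem MDSpace.congr_map {X Y : MDSpace} {f g : X ⟶ Y} (h : f = g) (x : X.carrier) :
    f.map x = g.map x := by rw [h]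

/-- The closure of a set `G` of paths under reparametrization by `M(1,1)` and normalized
composition. -/
inductive GenExec {C : Type} [TopologicalSpace C] (G : (I → C) → Prop) :
    ∀ {x y : C}, Path x y → Prop
  | of {x y : C} (p : Path x y) : G p → GenExec G p
  | reparam {x y : C} {p q : Path x y} (φ : I → I) : IsReparam φ → (∀ t, q t = p (φ t)) →
      GenExec G p → GenExec G q
  | trans {x y z : C} {p : Path x y} {q : Path y z} : GenExec G p → GenExec G q →
      GenExec G (p.trans q)

/-- The multipointed `d`-space on the space `C` with set of states `S` whose execution paths are
generated by the set of paths `G`. -/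
def MDSpace.generated (C : Type) [TopologicalSpace C] [DeltaGeneratedSpace C] (S : Set C)
    (G : (I → C) → Prop) (hG : ∀ p, G p → p 0 ∈ S ∧ p 1 ∈ S) : MDSpace where
  carrier := C
  states := S
  exec _ _ := {p | GenExec G p}
  exec_states {x y p} hp := by
    induction hp with
    | of p h => simpa using hG p h
    | reparam φ _ _ _ ih => exact ih
    | trans _ _ ih ih' => exact ⟨ih.1, ih'.2⟩
  exec_reparam hp φ hφ _ hq := .reparam φ hφ hq hp
  exec_trans hp hq := .trans hp hq

/-- Maps out of a generated multipointed `d`-space need only be tested on generators. -/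
def MDSpace.genHom {C : Type} [TopologicalSpace C] [DeltaGeneratedSpace C] {S : Set C}
    {G : (I → C) → Prop} {hG : ∀ p, G p → p 0 ∈ S ∧ p 1 ∈ S} {Y : MDSpace}
    (f : C(C, Y.carrier)) (hS : ∀ x ∈ S, f x ∈ Y.states)
    (hf : ∀ {x y : C} (p : Path x y), G p → p.map f.continuous ∈ Y.exec (f x) (f y)) :
    MDSpace.generated C S G hG ⟶ Y where
  map := f
  map_states := hS
  map_exec {x y} p hp := by
    induction hp with
    | of p h => exact hf p h
    | reparam φ hφ h _ ih => exact Y.exec_reparam ih φ hφ _ fun t => congrArg f (h t)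
    | trans _ _ ih ih' =>
      refine Y.exec_congr (Y.exec_trans ih ih') fun t => ?_
      rw [← Path.map_trans]

/-! ### Realizations of graphs -/

section Realization

variable {V E : Type} [TopologicalSpace V] (src tgt : E → V)

/-- The identification of the ends of the segment of an edge with its two vertices. -/
inductive RealizationRel : V ⊕ (Σ _ : E, I) → V ⊕ (Σ _ : E, I) → Prop
  | src (e : E) : RealizationRel (.inr ⟨e, 0⟩) (.inl (src e))
  | tgt (e : E) : RealizationRel (.inr ⟨e, 1⟩) (.inl (tgt e))

/-- The geometric realization of a graph. -/
abbrev RealizationCarrier : Type := Quot (RealizationRel src tgt)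

/-- A vertex in the realization of a graph. -/
def rvert (v : V) : RealizationCarrier src tgt := Quot.mk _ (.inl v)

/-- The segment of an edge in the realization of a graph. -/
def redge (e : E) : Path (rvert src tgt (src e)) (rvert src tgt (tgt e)) where
  toFun t := Quot.mk _ (.inr ⟨e, t⟩)
  continuous_toFun := continuous_quot_mk.comp (continuous_inr.comp continuous_sigmaMk)
  source' := Quot.sound (.src e)
  target' := Quot.sound (.tgt e)

theorem realization_cases (x : RealizationCarrier src tgt) :
    (∃ v, x = rvert src tgt v) ∨ ∃ e t, x = redge src tgt e t := by
  obtain ⟨v | ⟨e, t⟩, rfl⟩ := Quot.exists_rep x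
  · exact .inl ⟨v, rfl⟩
  · exact .inr ⟨e, t, rfl⟩

variable [DiscreteTopology V]

variable {src tgt}

/-- Continuous maps out of the realization of a graph. -/
def realizationDesc {Y : Type*} [TopologicalSpace Y] (v : V → Y) (p : E → C(I, Y))
    (h0 : ∀ e, p e 0 = v (src e)) (h1 : ∀ e, p e 1 = v (tgt e)) :
    C(RealizationCarrier src tgt, Y) where
  toFun := Quot.lift (Sum.elim v fun s => p s.1 s.2) (by
    rintro _ _ (e | e)
    · exact h0 e
    · exact h1 e)
  continuous_toFun := continuous_quot_lift _ (continuous_of_discreteTopology.sumElim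
    (continuous_sigma fun e => (p e).continuous))

variable (src tgt)

/-- The tame realization of a graph: the execution paths are generated by the edges. -/
def realization : MDSpace :=
  MDSpace.generated (RealizationCarrier src tgt) (Set.range (rvert src tgt))
    (fun p => ∃ e, ∀ t, p t = redge src tgt e t) (by
      rintro p ⟨e, h⟩
      rw [h, h, Path.source, Path.target]
      exact ⟨⟨_, rfl⟩, ⟨_, rfl⟩⟩)

variable {src tgt} in
/-- The map out of the tame realization of a graph given by states and execution paths. -/
def realizationHom {Y : MDSpace} (v : V → Y.carrier) (hv : ∀ a, v a ∈ Y.states)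
    (p : ∀ e, Path (v (src e)) (v (tgt e))) (hp : ∀ e, p e ∈ Y.exec _ _) :
    realization src tgt ⟶ Y :=
  MDSpace.genHom (realizationDesc v (fun e => (p e).toContinuousMap) (fun e => (p e).source)
    fun e => (p e).target)
    (by rintro _ ⟨a, rfl⟩; exact hv a)
    (by
      rintro x y q ⟨e, he⟩
      exact Y.exec_congr (hp e) fun t => by rw [Path.map_coe, Function.comp_apply, he]; rfl)

/-- The universal property of the tame realization. -/
def realizationTame : TameRealization ⟨V, E, src, tgt⟩ (realization src tgt) where
  vert := rvert src tgt
  vert_mem v := ⟨v, rfl⟩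
  edge := redge src tgt
  edge_mem e := .of _ ⟨e, fun _ => rfl⟩
  universal Y v hv p hp := by
    refine ⟨realizationHom v hv p hp, ⟨fun _ => rfl, fun _ _ => rfl⟩, fun h hh => ?_⟩
    refine MDSpace.hom_ext fun x => ?_
    obtain ⟨a, rfl⟩ | ⟨e, t, rfl⟩ := realization_cases src tgt x
    · exact hh.1 a
    · exact hh.2 e t

end Realization

/-! ### Maps out of globes -/

section Glob

variable {Z : Type} [TopologicalSpace Z]

theorem glob_cases (x : GlobCarrier Z) : (∃ b, x = globState b) ∨ ∃ z t, x = globPt z t := by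
  obtain ⟨b | ⟨z, t⟩, rfl⟩ := Quot.exists_rep x
  · exact .inl ⟨b, rfl⟩
  · exact .inr ⟨z, t, rfl⟩

theorem glob_cases_of_nonempty [Nonempty Z] (x : GlobCarrier Z) : ∃ z t, x = globPt z t := by
  obtain ⟨b, rfl⟩ | h := glob_cases x
  · obtain ⟨z⟩ := ‹Nonempty Z›
    cases b
    · exact ⟨z, 0, (globPt_zero z).symm⟩
    · exact ⟨z, 1, (globPt_one z).symm⟩
  · exact h

/-- Continuous maps out of a globe. -/
def globDesc {Y : Type*} [TopologicalSpace Y] (y : Bool → Y) (F : C(Z × I, Y))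
    (h0 : ∀ z, F (z, 0) = y false) (h1 : ∀ z, F (z, 1) = y true) : C(GlobCarrier Z, Y) where
  toFun := Quot.lift (Sum.elim y fun s => F (ofKel s)) (by
    rintro _ _ (z | z)
    · exact h0 z
    · exact h1 z)
  continuous_toFun := continuous_quot_lift _ (continuous_of_discreteTopology.sumElim
    (F.continuous.comp Topology.WithGeneratedByTopology.continuous_equiv))

/-- Maps out of the globe of `Z`: a family of execution paths between two given states which is
continuously parametrized by `Z`. -/
def globHom {Y : MDSpace} (y : Bool → Y.carrier) (hy : ∀ b, y b ∈ Y.states)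
    (F : C(Z × I, Y.carrier)) (h0 : ∀ z, F (z, 0) = y false) (h1 : ∀ z, F (z, 1) = y true)
    (hF : ∀ z (p : Path (y false) (y true)), (∀ t, p t = F (z, t)) → p ∈ Y.exec _ _) :
    glob Z ⟶ Y where
  map := globDesc y F h0 h1
  map_states := by rintro _ ⟨b, rfl⟩; exact hy b
  map_exec := by
    rintro a b p ⟨z, φ, hφ, h⟩
    let q : Path (y false) (y true) :=
      { toFun := fun t => F (z, t)
        continuous_toFun := by fun_prop
        source' := h0 z
        target' := h1 z }
    have hq : q ∈ Y.exec _ _ := hF z q fun _ => rfl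
    let q' : Path (y false) (y true) :=
      { toFun := fun t => F (z, φ t)
        continuous_toFun := by have := hφ.continuous; fun_prop
        source' := by rw [hφ.zero, h0]
        target' := by rw [hφ.one, h1] }
    exact Y.exec_congr (Y.exec_reparam hq φ hφ q' fun _ => rfl) fun t => congrArg _ (h t)

variable (Z) in
theorem globState_mem (b : Bool) : (globState b : GlobCarrier Z) ∈ (glob Z).states := ⟨b, rfl⟩

/-- The generating execution path `t ↦ (z,t)` of a globe. -/
def globPath (z : Z) : Path (globState false : GlobCarrier Z) (globState true) where
  toFun := globPt z
  continuous_toFun := continuous_globPt z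
  source' := globPt_zero z
  target' := globPt_one z

theorem globPath_mem (z : Z) : globPath z ∈ (glob Z).exec _ _ :=
  ⟨z, _, IsReparam.id, fun _ => rfl⟩

theorem globHom_ext [Nonempty Z] {Y : MDSpace} {f g : glob Z ⟶ Y}
    (h : ∀ z t, f.map (globPt z t) = g.map (globPt z t)) : f = g :=
  MDSpace.hom_ext fun x => by
    obtain ⟨z, t, rfl⟩ := glob_cases_of_nonempty x
    exact h z t

theorem continuous_globPt_prod [DeltaGeneratedSpace (Z × I)] :
    Continuous fun s : Z × I => globPt s.1 s.2 :=
  continuous_quot_mk.comp (continuous_inr.comp (continuous_toKel_comp continuous_id))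

end Glob

/-! ### Pushouts -/

theorem isPushout_of_desc {C : Type*} [Category* C] {Z X Y P : C} {f : Z ⟶ X} {g : Z ⟶ Y}
    {inl : X ⟶ P} {inr : Y ⟶ P} (w : f ≫ inl = g ≫ inr)
    (desc : ∀ (W : C) (a : X ⟶ W) (b : Y ⟶ W), f ≫ a = g ≫ b →
      ∃ d : P ⟶ W, inl ≫ d = a ∧ inr ≫ d = b)
    (ext : ∀ (W : C) (d d' : P ⟶ W), inl ≫ d = inl ≫ d' → inr ≫ d = inr ≫ d' → d = d') :
    IsPushout f g inl inr :=
  ⟨⟨w⟩, ⟨Limits.PushoutCocone.IsColimit.mk w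
    (fun s => (desc _ s.inl s.inr s.condition).choose)
    (fun s => (desc _ s.inl s.inr s.condition).choose_spec.1)
    (fun s => (desc _ s.inl s.inr s.condition).choose_spec.2)
    (fun s _ h1 h2 => ext _ _ _
      (h1.trans (desc _ s.inl s.inr s.condition).choose_spec.1.symm)
      (h2.trans (desc _ s.inl s.inr s.condition).choose_spec.2.symm))⟩⟩

section Pushout

variable {Z X Y : MDSpace} (f : Z ⟶ X) (g : Z ⟶ Y)

/-- The identifications in the pushout of `f` and `g`. -/
inductive PushRel : X.carrier ⊕ Y.carrier → X.carrier ⊕ Y.carrier → Prop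
  | glue (z : Z.carrier) : PushRel (.inl (f.map z)) (.inr (g.map z))

/-- The pushout of multipointed `d`-spaces: the execution paths of the pushout of the underlying
spaces are generated by the images of those of the two summands. -/
def pushout : MDSpace :=
  MDSpace.generated (Quot (PushRel f g))
    ((fun x => Quot.mk _ (.inl x)) '' X.states ∪ (fun y => Quot.mk _ (.inr y)) '' Y.states)
    (fun p => (∃ (x x' : X.carrier) (q : Path x x'), q ∈ X.exec x x' ∧
        ∀ t, p t = Quot.mk _ (.inl (q t))) ∨
      ∃ (y y' : Y.carrier) (q : Path y y'), q ∈ Y.exec y y' ∧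
        ∀ t, p t = Quot.mk _ (.inr (q t)))
    (by
      rintro p (⟨x, x', q, hq, h⟩ | ⟨x, x', q, hq, h⟩)
      · rw [h, h, q.source, q.target]
        exact ⟨.inl ⟨_, (X.exec_states hq).1, rfl⟩, .inl ⟨_, (X.exec_states hq).2, rfl⟩⟩
      · rw [h, h, q.source, q.target]
        exact ⟨.inr ⟨_, (Y.exec_states hq).1, rfl⟩, .inr ⟨_, (Y.exec_states hq).2, rfl⟩⟩)

/-- The first inclusion into the pushout. -/
def pushInl : X ⟶ pushout f g where
  map := ⟨fun x => Quot.mk _ (.inl x), continuous_quot_mk.comp continuous_inl⟩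
  map_states x hx := .inl ⟨x, hx, rfl⟩
  map_exec p hp := .of _ (.inl ⟨_, _, p, hp, fun _ => rfl⟩)

/-- The second inclusion into the pushout. -/
def pushInr : Y ⟶ pushout f g where
  map := ⟨fun x => Quot.mk _ (.inr x), continuous_quot_mk.comp continuous_inr⟩
  map_states x hx := .inr ⟨x, hx, rfl⟩
  map_exec p hp := .of _ (.inr ⟨_, _, p, hp, fun _ => rfl⟩)

theorem push_glue (z : Z.carrier) :
    (pushInl f g).map (f.map z) = (pushInr f g).map (g.map z) := Quot.sound (.glue z)

theorem push_cases (x : (pushout f g).carrier) :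
    (∃ a, x = (pushInl f g).map a) ∨ ∃ b, x = (pushInr f g).map b := by
  obtain ⟨a | b, rfl⟩ := Quot.exists_rep x
  · exact .inl ⟨a, rfl⟩
  · exact .inr ⟨b, rfl⟩

variable {f g}

/-- Continuous maps out of a pushout. -/
def pushDescMap {W : Type*} [TopologicalSpace W] (a : C(X.carrier, W)) (b : C(Y.carrier, W))
    (h : ∀ z, a (f.map z) = b (g.map z)) : C((pushout f g).carrier, W) where
  toFun := Quot.lift (Sum.elim a b) (by rintro _ _ ⟨z⟩; exact h z)
  continuous_toFun := continuous_quot_lift _ (a.continuous.sumElim b.continuous)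

theorem push_hom_ext {W : MDSpace} {d d' : pushout f g ⟶ W}
    (h1 : pushInl f g ≫ d = pushInl f g ≫ d') (h2 : pushInr f g ≫ d = pushInr f g ≫ d') :
    d = d' := by
  refine MDSpace.hom_ext fun x => ?_
  obtain ⟨a, rfl⟩ | ⟨b, rfl⟩ := push_cases f g x
  · exact MDSpace.congr_map h1 a
  · exact MDSpace.congr_map h2 b

/-- The map out of a pushout given by a commutative square. -/
def pushDesc {W : MDSpace} (a : X ⟶ W) (b : Y ⟶ W) (h : f ≫ a = g ≫ b) : pushout f g ⟶ W :=
  MDSpace.genHom (pushDescMap a.map b.map fun z => MDSpace.congr_map h z)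
    (by
      rintro _ (⟨x, hx, rfl⟩ | ⟨x, hx, rfl⟩)
      · exact a.map_states x hx
      · exact b.map_states x hx)
    (by
      rintro x y p (⟨x', y', q, hq, h'⟩ | ⟨x', y', q, hq, h'⟩)
      · exact W.exec_congr (a.map_exec q hq) fun t =>
          congrArg (pushDescMap a.map b.map fun z => MDSpace.congr_map h z) (h' t)
      · exact W.exec_congr (b.map_exec q hq) fun t =>
          congrArg (pushDescMap a.map b.map fun z => MDSpace.congr_map h z) (h' t))

theorem inl_pushDesc {W : MDSpace} (a : X ⟶ W) (b : Y ⟶ W) (h : f ≫ a = g ≫ b) :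
    pushInl f g ≫ pushDesc a b h = a := rfl

theorem inr_pushDesc {W : MDSpace} (a : X ⟶ W) (b : Y ⟶ W) (h : f ≫ a = g ≫ b) :
    pushInr f g ≫ pushDesc a b h = b := rfl

variable (f g)

theorem pushout_isPushout : IsPushout f g (pushInl f g) (pushInr f g) :=
  isPushout_of_desc (MDSpace.hom_ext (push_glue f g))
    (fun _ a b h => ⟨pushDesc a b h, inl_pushDesc a b h, inr_pushDesc a b h⟩)
    fun _ _ _ => push_hom_ext

end Pushout

/-! ### A criterion for trivial Serre fibrations -/

theorem deltaGenerated_cube_prod (n : ℕ) : DeltaGeneratedSpace ((Fin n → I) × I) := by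
  have hq : IsQuotientMap (fun v : Fin (n + 1) → ℝ =>
      ((fun i => Set.projIcc (0 : ℝ) 1 zero_le_one (v i.succ),
        Set.projIcc (0 : ℝ) 1 zero_le_one (v 0)) : (Fin n → I) × I)) := by
    refine IsQuotientMap.of_inverse
      (f := fun s => Fin.cons (s.2 : ℝ) (fun i => (s.1 i : ℝ))) ?_ ?_ ?_
    · refine continuous_pi fun i => ?_
      refine Fin.cases ?_ (fun j => ?_) i
      · simp only [Fin.cons_zero]; fun_prop
      · simp only [Fin.cons_succ]; fun_prop
    · have := continuous_projIcc (α := ℝ) (a := 0) (b := 1) (h := zero_le_one)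
      fun_prop
    · rintro ⟨a, b⟩
      simp
  exact hq.isGeneratedBy

theorem deltaGenerated_prod_cube (n : ℕ) : DeltaGeneratedSpace (I × (Fin n → I)) :=
  have := deltaGenerated_cube_prod n
  (Homeomorph.prodComm (Fin n → I) I).isQuotientMap.isGeneratedBy

theorem deltaGenerated_cube (n : ℕ) : DeltaGeneratedSpace (Fin n → I) :=
  have := deltaGenerated_cube_prod n
  (IsQuotientMap.of_inverse (f := fun s : Fin n → I => (s, (0 : I))) (g := Prod.fst) (by fun_prop)
    continuous_fst fun _ => rfl).isGeneratedBy

/-- The affine path from `a` to `b` in the unit interval. -/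
def lerp (a b s : I) : I :=
  ⟨(1 - (s : ℝ)) * a + s * b, by
    have ha := a.2; have hb := b.2; have hs := s.2
    constructor
    · have := mul_nonneg (sub_nonneg.2 hs.2) ha.1
      have := mul_nonneg hs.1 hb.1
      linarith
    · have := mul_nonneg (sub_nonneg.2 hs.2) (sub_nonneg.2 ha.2)
      have := mul_nonneg hs.1 (sub_nonneg.2 hb.2)
      linarith⟩

theorem lerp_zero (a b : I) : lerp a b 0 = a := Subtype.ext (by simp [lerp])
theorem lerp_one (a b : I) : lerp a b 1 = b := Subtype.ext (by simp [lerp])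
theorem lerp_self (a s : I) : lerp a a s = a := Subtype.ext (by simp only [lerp]; ring)

theorem continuous_lerp {D : Type*} [TopologicalSpace D] {a b s : D → I} (ha : Continuous a)
    (hb : Continuous b) (hs : Continuous s) : Continuous fun d => lerp (a d) (b d) (s d) := by
  unfold lerp
  fun_prop

/-- Data exhibiting each fibre of `f : X → Y` as a retract of the interval, continuously in the
point of `Y`: the coordinate `coord` embeds the fibres in `I`, and `lift y` retracts `I` onto the
fibre over `y`. Continuity of `lift` in both variables is only required along maps from
`Δ`-generated spaces: this suffices for maps from cubes, and it is what is available when `X` is a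
`Δ`-kelleyfication. -/
structure IntervalFibration {X Y : Type*} [TopologicalSpace X] [TopologicalSpace Y]
    (f : C(X, Y)) where
  coord : C(X, I)
  lift : Y → I → X
  continuous_lift : ∀ {D : Type} [TopologicalSpace D] [DeltaGeneratedSpace D] {a : D → Y}
    {s : D → I}, Continuous a → Continuous s → Continuous fun d => lift (a d) (s d)
  map_lift : ∀ y s, f (lift y s) = y
  lift_map : ∀ x, lift (f x) (coord x) = x

variable {X Y : Type*} [TopologicalSpace X] [TopologicalSpace Y] {f : C(X, Y)}

/-- A homotopy is lifted by keeping the coordinate in the fibre constant. -/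
theorem IntervalFibration.isSerreFibration (F : IntervalFibration f) : IsSerreFibration f := by
  intro n h H hH
  have := deltaGenerated_cube_prod n
  refine ⟨⟨fun s => F.lift (H s) (F.coord (h s.1)), F.continuous_lift H.continuous (by fun_prop)⟩,
    fun s => ?_, fun s => F.map_lift _ _⟩
  change F.lift (H (s, 0)) (F.coord (h s)) = h s
  rw [hH, F.lift_map]

theorem IntervalFibration.zerothMap_bijective (F : IntervalFibration f) :
    Function.Bijective (zerothMap f) := by
  constructor
  · rintro ⟨x⟩ ⟨y⟩ h
    obtain ⟨p⟩ : Joined (f x) (f y) := Quotient.exact h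
    refine Quotient.sound ⟨⟨⟨fun t => F.lift (p t) (lerp (F.coord x) (F.coord y) t),
      F.continuous_lift p.continuous (continuous_lerp continuous_const continuous_const
        continuous_id)⟩, ?_, ?_⟩⟩
    · change F.lift (p 0) (lerp (F.coord x) (F.coord y) 0) = x
      rw [lerp_zero, p.source, F.lift_map]
    · change F.lift (p 1) (lerp (F.coord x) (F.coord y) 1) = y
      rw [lerp_one, p.target, F.lift_map]
  · rintro ⟨y⟩
    exact ⟨Quotient.mk _ (F.lift y 0), congrArg (Quotient.mk _) (F.map_lift y 0)⟩

/-- Given a homotopy between the images of two loops, the coordinates of the loops in the fibres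
are joined affinely, which is constant wherever the two loops agree. -/
theorem IntervalFibration.piMap_bijective (F : IntervalFibration f) (n : ℕ) (x : X) :
    Function.Bijective (piMap f n x) := by
  have := deltaGenerated_cube n
  have := deltaGenerated_prod_cube n
  constructor
  · rintro ⟨γ⟩ ⟨γ'⟩ h
    obtain ⟨G⟩ : ContinuousMap.HomotopicRel (f.comp γ.1) (f.comp γ'.1) (Cube.boundary (Fin n)) :=
      Quotient.exact h
    refine Quotient.sound ⟨⟨⟨⟨fun s => F.lift (G s)
        (lerp (F.coord (γ.1 s.2)) (F.coord (γ'.1 s.2)) s.1),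
      F.continuous_lift G.continuous (continuous_lerp (by fun_prop) (by fun_prop) continuous_fst)⟩,
      fun u => ?_, fun u => ?_⟩, fun t u hu => ?_⟩⟩
    · change F.lift (G (0, u)) (lerp (F.coord (γ.1 u)) (F.coord (γ'.1 u)) 0) = γ.1 u
      rw [lerp_zero, G.apply_zero]
      exact F.lift_map _
    · change F.lift (G (1, u)) (lerp (F.coord (γ.1 u)) (F.coord (γ'.1 u)) 1) = γ'.1 u
      rw [lerp_one, G.apply_one]
      exact F.lift_map _
    · change F.lift (G (t, u)) (lerp (F.coord (γ.1 u)) (F.coord (γ'.1 u)) t) = γ.1 u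
      rw [G.eq_fst t hu, show γ'.1 u = γ.1 u from (γ'.2 u hu).trans (γ.2 u hu).symm, lerp_self]
      exact F.lift_map _
  · rintro ⟨δ⟩
    refine ⟨Quotient.mk _ ⟨⟨fun u => F.lift (δ.1 u) (F.coord x),
      F.continuous_lift δ.1.continuous continuous_const⟩, fun u hu => ?_⟩, ?_⟩
    · change F.lift (δ.1 u) (F.coord x) = x
      rw [δ.2 u hu, F.lift_map]
    · exact congrArg (Quotient.mk _) (Subtype.ext (ContinuousMap.ext fun u => F.map_lift _ _))

theorem IntervalFibration.isWeakHomotopyEquiv (F : IntervalFibration f) :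
    IsWeakHomotopyEquiv f :=
  ⟨F.zerothMap_bijective, fun n _ x => F.piMap_bijective n x⟩

/-- A map with a continuous inverse. -/
def IntervalFibration.ofInverse (g : C(Y, X)) (h1 : ∀ y, f (g y) = y) (h2 : ∀ x, g (f x) = x) :
    IntervalFibration f where
  coord := ContinuousMap.const _ 0
  lift y _ := g y
  continuous_lift ha _ := g.continuous.comp ha
  map_lift y _ := h1 y
  lift_map := h2

/-! ### Path components and the homotopy category -/

/-- The functor of path components. -/
def pi0 : DeltaGenerated.{0} ⥤ Type where
  obj X := ZerothHomotopy X
  map f := TypeCat.ofHom (zerothMap (DeltaGenerated.deltaGeneratedToTop.map f).hom)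
  map_id X := by ext ⟨x⟩; rfl
  map_comp f g := by ext ⟨x⟩; rfl

/-- Weak homotopy equivalences are bijective on path components, so that the functor of path
components factors through the localization. -/
theorem zerothMap_bijective_of_isIso_toHo {X Y : DeltaGenerated.{0}} (f : X ⟶ Y)
    [IsIso (toHo.map f)] :
    Function.Bijective (zerothMap (DeltaGenerated.deltaGeneratedToTop.map f).hom) := by
  have hW : weakEquivalences.IsInvertedBy pi0 := fun _ _ g hg =>
    (isIso_iff_bijective _).2 hg.1
  have h1 : IsIso ((toHo ⋙ Localization.lift pi0 hW toHo).map f) :=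
    inferInstanceAs (IsIso ((Localization.lift pi0 hW toHo).map (toHo.map f)))
  have h2 : IsIso (pi0.map f) :=
    (NatIso.isIso_map_iff (Localization.fac pi0 hW toHo) f).1 h1
  exact (isIso_iff_bijective (pi0.map f)).1 h2

/-! ### Finite cellular multipointed d-spaces -/

/-- A pushout of one of the maps `Glob(S^{n-1}) → Glob(D^n)`. -/
def IsCellAttachment {X Y : MDSpace} (m : X ⟶ Y) : Prop :=
  ∃ (n : ℕ) (g : glob (Sph n) ⟶ X) (g' : glob (Disk n) ⟶ Y), IsPushout g (globIncl n) m g'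

/-- `Y` is obtained from `X` by finitely many cell attachments. -/
inductive FiniteAttachment : MDSpace → MDSpace → Prop
  | refl (X : MDSpace) : FiniteAttachment X X
  | cons {X Y Z : MDSpace} (m : X ⟶ Y) : IsCellAttachment m → FiniteAttachment Y Z →
      FiniteAttachment X Z

theorem FiniteAttachment.exists_composableArrows {X Y : MDSpace} (h : FiniteAttachment X Y) :
    ∃ (n : ℕ) (F : ComposableArrows MDSpace n), F.left = X ∧ F.right = Y ∧
      ∀ (i : ℕ) (hi : i < n), IsCellAttachment (F.map' i (i + 1)) := by
  induction h with
  | refl X => exact ⟨0, ComposableArrows.mk₀ X, rfl, rfl, fun i hi => by omega⟩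
  | cons m hm _ ih =>
    obtain ⟨n, F, rfl, rfl, hF⟩ := ih
    refine ⟨n + 1, F.precomp m, rfl, rfl, fun i hi => ?_⟩
    cases i with
    | zero => exact hm
    | succ i => exact hF i (by omega)

theorem FiniteAttachment.isCellular {S : Type} {X : MDSpace}
    (h : FiniteAttachment (MDSpace.discrete S) X) : X.IsCellular := by
  obtain ⟨n, F, hl, rfl, hF⟩ := h.exists_composableArrows
  refine ⟨S, eqToHom hl.symm ≫ F.hom, Fin (n + 1), inferInstance, inferInstance, inferInstance,
    inferInstance, (TransfiniteCompositionOfShape.ofComposableArrows F).ofArrowIso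
      (Arrow.isoMk (eqToIso hl) (Iso.refl _)), ?_⟩
  intro j hj
  have key : ∀ (i : ℕ) (hi : i < n) (k : Fin (n + 1)) (hk : j ≤ k), (j : ℕ) = i → (k : ℕ) = i + 1 →
      IsCellAttachment (F.map (homOfLE hk)) := by
    rintro i hi ⟨k, hk'⟩ hk rfl h2
    obtain rfl : k = j + 1 := h2
    exact hF j hi
  have hj' : (j : ℕ) < n := by
    rcases lt_or_eq_of_le (Nat.lt_succ_iff.1 j.2) with h | h
    · exact h
    · exact absurd (fun b _ => Fin.le_def.2 (by omega)) hj
  refine key j hj' (Order.succ j) (Order.le_succ j) rfl ?_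
  have : Order.succ j = ⟨j + 1, by omega⟩ := by
    refine le_antisymm (Order.succ_le_of_lt (Fin.lt_def.2 (Nat.lt_succ_self _))) ?_
    exact Fin.le_def.2 (Order.lt_succ_of_not_isMax hj)
  rw [this]

instance instIsEmptySphZero : IsEmpty (Sph 0) := ⟨fun z => by
  have h := z.2
  rw [mem_sphere_zero_iff_norm, Subsingleton.elim (z : EuclideanSpace ℝ (Fin 0)) 0, norm_zero] at h
  exact zero_ne_one h⟩

theorem globHom_ext_of_isEmpty {Z : Type} [TopologicalSpace Z] [IsEmpty Z] {Y : MDSpace}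
    {f g : glob Z ⟶ Y} (h : ∀ b, f.map (globState b) = g.map (globState b)) : f = g :=
  MDSpace.hom_ext fun x => by
    obtain ⟨b, rfl⟩ | ⟨z, _⟩ := glob_cases x
    · exact h b
    · exact isEmptyElim z

/-- A globe on the empty space is a pair of states. -/
def globHomOfIsEmpty {Z : Type} [TopologicalSpace Z] [IsEmpty Z] {Y : MDSpace}
    (y : Bool → Y.carrier) (hy : ∀ b, y b ∈ Y.states) : glob Z ⟶ Y :=
  globHom y hy ⟨fun s => isEmptyElim s.1, continuous_of_const fun s => isEmptyElim s.1⟩ isEmptyElim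
    isEmptyElim isEmptyElim

/-- The map from a globe which is constant in `Z`, given by an execution path. -/
def globHomOfPath (Z : Type) [TopologicalSpace Z] {Y : MDSpace} {x y : Y.carrier} (p : Path x y)
    (hp : p ∈ Y.exec x y) : glob Z ⟶ Y :=
  globHom (fun b => if b then y else x)
    (by rintro (_ | _); exacts [(Y.exec_states hp).1, (Y.exec_states hp).2])
    ⟨fun s => p s.2, by fun_prop⟩ (fun _ => p.source) (fun _ => p.target)
    fun _ _ h => Y.exec_congr hp h

theorem TameRealization.hom_ext {K : PrecubicalSet₁} {X Y : MDSpace} (r : TameRealization K X)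
    {f g : X ⟶ Y} (hv : ∀ v, f.map (r.vert v) = g.map (r.vert v))
    (he : ∀ e t, f.map (r.edge e t) = g.map (r.edge e t)) : f = g := by
  obtain ⟨h, _, hu⟩ := r.universal Y (fun v => g.map (r.vert v))
    (fun v => g.map_states _ (r.vert_mem v)) (fun e => (r.edge e).map g.map.continuous)
    (fun e => g.map_exec _ (r.edge_mem e))
  rw [hu f ⟨hv, he⟩, hu g ⟨fun _ => rfl, fun _ _ => rfl⟩]

instance instNonemptyDisk (n : ℕ) : Nonempty (Disk n) := ⟨⟨0, by simp⟩⟩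

/-- Adding an edge to a graph attaches a globe `Glob(D⁰)` to its tame realization. -/
theorem exists_isCellAttachment_of_addEdge {V : Type} {n : ℕ} {src tgt : Fin (n + 1) → V}
    {X Y : MDSpace}
    (r : TameRealization ⟨V, Fin n, fun e => src e.castSucc, fun e => tgt e.castSucc⟩ X)
    (r' : TameRealization ⟨V, Fin (n + 1), src, tgt⟩ Y) :
    ∃ m : X ⟶ Y, IsCellAttachment m := by
  obtain ⟨m, ⟨hmv, hme⟩, -⟩ := r.universal Y r'.vert r'.vert_mem (fun e => r'.edge e.castSucc)
    fun e => r'.edge_mem e.castSucc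
  dsimp only at hmv hme
  let e0 : Fin (n + 1) := Fin.last n
  let s : Bool → V := fun b => if b then tgt e0 else src e0
  refine ⟨m, 0, globHomOfIsEmpty (fun b => r.vert (s b)) (fun b => r.vert_mem _),
    globHomOfPath _ (r'.edge e0) (r'.edge_mem e0), isPushout_of_desc ?_ ?_ ?_⟩
  · refine globHom_ext_of_isEmpty fun b => ?_
    refine (hmv (s b)).trans ?_
    cases b <;> rfl
  · intro W a b hab
    let z : Disk 0 := Classical.arbitrary _
    have hs : ∀ c, a.map (r.vert (s c)) = b.map (globState c) := fun c =>
      MDSpace.congr_map hab (globState c)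
    let p : ∀ e, Path (a.map (r.vert (src e))) (a.map (r.vert (tgt e))) :=
      Fin.lastCases (((globPath z).map b.map.continuous).cast (hs false) (hs true))
        fun e => (r.edge e).map a.map.continuous
    have hp : ∀ e, p e ∈ W.exec _ _ := by
      refine Fin.lastCases ?_ fun e => ?_
      · refine W.exec_congr (b.map_exec _ (globPath_mem z)) fun t => ?_
        simp only [p, Fin.lastCases_last]
        rfl
      · simp only [p, Fin.lastCases_castSucc]
        exact a.map_exec _ (r.edge_mem e)
    obtain ⟨d, ⟨hdv, hde⟩, -⟩ := r'.universal W (fun v => a.map (r.vert v))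
      (fun v => a.map_states _ (r.vert_mem v)) p hp
    dsimp only at hdv hde
    refine ⟨d, r.hom_ext (fun v => ?_) fun e t => ?_, globHom_ext fun z' t => ?_⟩
    · rw [MDSpace.comp_map, hmv, hdv]
    · rw [MDSpace.comp_map, hme, hde]
      simp only [p, Fin.lastCases_castSucc]
      rfl
    · change d.map (r'.edge e0 t) = _
      rw [hde, Subsingleton.elim z' z]
      simp only [p, e0, Fin.lastCases_last]
      rfl
  · intro W d d' h1 h2
    refine r'.hom_ext (fun v => ?_) fun e => ?_
    · rw [← hmv v]
      exact MDSpace.congr_map h1 (r.vert v)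
    · refine Fin.lastCases (fun t => ?_) (fun e t => ?_) e
      · exact MDSpace.congr_map h2 (globPt (Classical.arbitrary (Disk 0)) t)
      · rw [← hme e t]
        exact MDSpace.congr_map h1 (r.edge e t)

/-- A set without execution paths is the tame realization of a graph without edges. -/
def discreteTame (V : Type) (src tgt : Fin 0 → V) :
    TameRealization ⟨V, Fin 0, src, tgt⟩ (MDSpace.discrete V) where
  vert v := v
  vert_mem _ := trivial
  edge e := e.elim0
  edge_mem e := e.elim0
  universal Y v hv p _ := by
    let h : MDSpace.discrete V ⟶ Y :=
      { map := ⟨v, continuous_bot⟩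
        map_states := fun x _ => hv x
        map_exec := fun _ hp => hp.elim }
    exact ⟨h, ⟨fun _ => rfl, fun e => e.elim0⟩, fun _ h' => MDSpace.hom_ext h'.1⟩

theorem FiniteAttachment.snoc {X Y Z : MDSpace} (h : FiniteAttachment X Y) (m : Y ⟶ Z)
    (hm : IsCellAttachment m) : FiniteAttachment X Z := by
  induction h with
  | refl X => exact .cons m hm (.refl _)
  | cons m' hm' _ ih => exact .cons m' hm' (ih m hm)

theorem TameRealization.finiteAttachment {V : Type} [TopologicalSpace V] [DiscreteTopology V]
    {n : ℕ} {src tgt : Fin (n + 1) → V} {Y : MDSpace}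
    (r : TameRealization ⟨V, Fin (n + 1), src, tgt⟩ Y) :
    FiniteAttachment (MDSpace.discrete V) Y := by
  induction n generalizing Y with
  | zero =>
    obtain ⟨m, hm⟩ := exists_isCellAttachment_of_addEdge (discreteTame V _ _) r
    exact .cons m hm (.refl _)
  | succ n ih =>
    obtain ⟨m, hm⟩ := exists_isCellAttachment_of_addEdge
      (realizationTame (fun e => src (Fin.castSucc e)) fun e => tgt (Fin.castSucc e)) r
    exact (ih (realizationTame _ _)).snoc m hm

/-! ### Attaching the globe of a segment along one end -/

/-- The left end of `D¹`. -/
def diskLeft : Sph 1 := ⟨EuclideanSpace.single 0 (-1), by simp⟩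

/-- The right end of `D¹`. -/
def diskRight : Sph 1 := ⟨EuclideanSpace.single 0 1, by simp⟩

theorem sph_one_coord (z : Sph 1) : z.1 0 = -1 ∨ z.1 0 = 1 := by
  have h := z.2
  rw [mem_sphere_zero_iff_norm, EuclideanSpace.norm_eq] at h
  simp only [Fin.sum_univ_one, Real.norm_eq_abs, Real.sqrt_sq_eq_abs, abs_abs] at h
  rcases abs_eq zero_le_one |>.1 h with h | h
  · exact .inr h
  · exact .inl h

theorem sph_one_cases (z : Sph 1) : z = diskLeft ∨ z = diskRight := by
  refine (sph_one_coord z).imp (fun h => ?_) fun h => ?_ <;>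
  · ext i
    rw [Subsingleton.elim i 0, h]
    simp [diskLeft, diskRight]

/-- The affine homeomorphism from `D¹` to the unit interval. -/
def diskToI : C(Disk 1, I) where
  toFun d := Set.projIcc 0 1 zero_le_one ((d.1 0 + 1) / 2)
  continuous_toFun := continuous_projIcc.comp (by fun_prop)

/-- The inverse of `diskToI`. -/
def iToDisk : C(I, Disk 1) where
  toFun t := ⟨EuclideanSpace.single 0 (2 * (t : ℝ) - 1), by
    have := t.2
    simp only [mem_closedBall_zero_iff, PiLp.norm_single, Real.norm_eq_abs, abs_le]
    constructor <;> linarith [this.1, this.2]⟩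
  continuous_toFun := by
    refine Continuous.subtype_mk ?_ _
    have h : (fun t : I => EuclideanSpace.single (0 : Fin 1) (2 * (t : ℝ) - 1)) =
        fun t : I => (2 * (t : ℝ) - 1) • EuclideanSpace.single (0 : Fin 1) (1 : ℝ) := by
      ext t i; simp
    rw [h]
    fun_prop

theorem diskToI_iToDisk (t : I) : diskToI (iToDisk t) = t := by
  simp [diskToI, iToDisk]

theorem iToDisk_diskToI (d : Disk 1) : iToDisk (diskToI d) = d := by
  have h := d.2
  rw [mem_closedBall_zero_iff, EuclideanSpace.norm_eq] at h
  simp only [Fin.sum_univ_one, Real.norm_eq_abs, Real.sqrt_sq_eq_abs, abs_abs, abs_le] at h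
  ext i
  rw [Subsingleton.elim i 0]
  simp only [iToDisk, diskToI, ContinuousMap.coe_mk, PiLp.single_apply, if_true]
  rw [Set.projIcc_of_mem zero_le_one (by constructor <;> linarith [h.1, h.2])]
  ring

theorem iToDisk_zero : iToDisk 0 = ⟨diskLeft.1, Metric.sphere_subset_closedBall diskLeft.2⟩ := by
  ext i; simp [iToDisk, diskLeft]

theorem iToDisk_one : iToDisk 1 = ⟨diskRight.1, Metric.sphere_subset_closedBall diskRight.2⟩ := by
  ext i; simp [iToDisk, diskRight]; norm_num

section AttachInterval

variable {B : MDSpace} (g : glob PUnit ⟶ B)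

/-- The pushout of `Glob({0}) ⊂ Glob([0,1])` along `g`. -/
def attachInterval : MDSpace := pushout g (globMap (ContinuousMap.const PUnit (0 : I)))

/-- The result of attaching to `B` an execution path with the same ends as `g`. -/
def attachParallel : MDSpace :=
  pushout (globHomOfIsEmpty (fun b => g.map (globState b))
    fun b => g.map_states _ (globState_mem _ b)) (globIncl 0)

/-- The inclusion of `B`. -/
def parInl : B ⟶ attachParallel g := pushInl _ _

/-- The added execution path. -/
def parInr : glob (Disk 0) ⟶ attachParallel g := pushInr _ _

theorem par_glue (b : Bool) :
    (parInl g).map (g.map (globState b)) = (parInr g).map (globState b) :=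
  push_glue (globHomOfIsEmpty (fun b => g.map (globState b))
    fun b => g.map_states _ (globState_mem _ b)) (globIncl 0) (globState b)

/-- The two boundary execution paths of the globe `Glob(D¹)` to be attached: the path `g` and the
path added in `attachParallel g`. -/
def boundaryMap (z : Sph 1) (t : I) : (attachParallel g).carrier :=
  if z.1 0 ≤ 0 then (parInl g).map (g.map (globPt PUnit.unit t))
  else (parInr g).map (globPt (Classical.arbitrary _) t)

theorem boundaryMap_left (t : I) :
    boundaryMap g diskLeft t = (parInl g).map (g.map (globPt PUnit.unit t)) :=
  if_pos (by simp [diskLeft])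

theorem boundaryMap_right (z : Disk 0) (t : I) :
    boundaryMap g diskRight t = (parInr g).map (globPt z t) := by
  rw [Subsingleton.elim z (Classical.arbitrary _)]
  exact if_neg (by simp [diskRight])

theorem continuous_boundaryMap : Continuous fun s : Sph 1 × I => boundaryMap g s.1 s.2 := by
  refine Continuous.if_le ?_ ?_ (by fun_prop) continuous_const fun s hs => ?_
  · exact (parInl g).map.continuous.comp (g.map.continuous.comp
      ((continuous_globPt _).comp continuous_snd))
  · exact (parInr g).map.continuous.comp ((continuous_globPt _).comp continuous_snd)
  · rcases sph_one_coord s.1 with h | h <;> rw [h] at hs <;> norm_num at hs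

/-- The attaching map of `Glob(D¹)`. -/
def boundaryHom : glob (Sph 1) ⟶ attachParallel g :=
  globHom (fun b => (parInl g).map (g.map (globState b)))
    (fun b => (parInl g).map_states _ (g.map_states _ (globState_mem _ b)))
    ⟨_, continuous_boundaryMap g⟩
    (fun z => by
      obtain rfl | rfl := sph_one_cases z
      · exact (boundaryMap_left g 0).trans (by rw [globPt_zero])
      · exact (boundaryMap_right g (Classical.arbitrary _) 0).trans
          (by rw [globPt_zero]; exact (par_glue g false).symm))
    (fun z => by
      obtain rfl | rfl := sph_one_cases z
      · exact (boundaryMap_left g 1).trans (by rw [globPt_one])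
      · exact (boundaryMap_right g (Classical.arbitrary _) 1).trans
          (by rw [globPt_one]; exact (par_glue g true).symm))
    (fun z p hp => by
      obtain rfl | rfl := sph_one_cases z
      · exact MDSpace.exec_congr _ ((g ≫ parInl g).map_exec _ (globPath_mem PUnit.unit)) fun t =>
          (hp t).trans (boundaryMap_left g t)
      · exact MDSpace.exec_congr _ ((parInr g).map_exec _ (globPath_mem (Classical.arbitrary _)))
          fun t => (hp t).trans (boundaryMap_right g _ t))

/-- The inclusion of `B`. -/
def attInl : B ⟶ attachInterval g := pushInl _ _

/-- The added globe. -/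
def attInr : glob I ⟶ attachInterval g := pushInr _ _

theorem att_glue (t : I) :
    (attInl g).map (g.map (globPt PUnit.unit t)) = (attInr g).map (globPt 0 t) :=
  push_glue g (globMap (ContinuousMap.const PUnit (0 : I))) (globPt PUnit.unit t)

theorem att_isPushout :
    IsPushout g (globMap (ContinuousMap.const PUnit (0 : I))) (attInl g) (attInr g) :=
  pushout_isPushout _ _

/-- The inclusion which takes the path added in `attachParallel g` to the free end of the family
of paths added in `attachInterval g`. -/
def parToAtt : attachParallel g ⟶ attachInterval g :=
  pushDesc (attInl g) (globMap (ContinuousMap.const (Disk 0) (1 : I)) ≫ attInr g)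
    (globHom_ext_of_isEmpty fun b => by
      change (attInl g).map (g.map (globState b)) = (attInr g).map (globState b)
      cases b
      · rw [← globPt_zero PUnit.unit, ← globPt_zero 0]; exact att_glue g 0
      · rw [← globPt_one PUnit.unit, ← globPt_one 0]; exact att_glue g 1)

theorem parToAtt_inl (x : B.carrier) :
    (parToAtt g).map ((parInl g).map x) = (attInl g).map x := rfl

theorem parToAtt_inr (z : Disk 0) (t : I) :
    (parToAtt g).map ((parInr g).map (globPt z t)) = (attInr g).map (globPt 1 t) := rfl

theorem isCellAttachment_parToAtt : IsCellAttachment (parToAtt g) := by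
  refine ⟨1, boundaryHom g, globMap diskToI ≫ attInr g, isPushout_of_desc ?_ ?_ ?_⟩
  · have : Nonempty (Sph 1) := ⟨diskLeft⟩
    refine globHom_ext fun z t => ?_
    obtain rfl | rfl := sph_one_cases z
    · refine (congrArg (parToAtt g).map (boundaryMap_left g t)).trans ?_
      rw [parToAtt_inl, att_glue]
      refine congrArg (fun s => (attInr g).map (globPt s t)) ?_
      rw [← diskToI_iToDisk 0, iToDisk_zero]
      rfl
    · refine (congrArg (parToAtt g).map
        (boundaryMap_right g (Classical.arbitrary _) t)).trans ?_
      rw [parToAtt_inr]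
      refine congrArg (fun s => (attInr g).map (globPt s t)) ?_
      rw [← diskToI_iToDisk 1, iToDisk_one]
      rfl
  · intro W a b h
    have hl (t : I) : a.map ((parInl g).map (g.map (globPt PUnit.unit t))) =
        b.map (globPt (iToDisk 0) t) := by
      rw [iToDisk_zero, ← boundaryMap_left]
      exact MDSpace.congr_map h (globPt diskLeft t)
    have hr (z : Disk 0) (t : I) : a.map ((parInr g).map (globPt z t)) =
        b.map (globPt (iToDisk 1) t) := by
      rw [iToDisk_one, ← boundaryMap_right]
      exact MDSpace.congr_map h (globPt diskRight t)
    refine ⟨pushDesc (parInl g ≫ a) (globMap iToDisk ≫ b) (globHom_ext fun _ t => hl t),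
      push_hom_ext rfl (globHom_ext fun z t => (hr z t).symm), globHom_ext fun d t => ?_⟩
    exact congrArg (fun d => b.map (globPt d t)) (iToDisk_diskToI d)
  · intro W d d' h1 h2
    refine push_hom_ext (MDSpace.hom_ext fun x => MDSpace.congr_map h1 ((parInl g).map x))
      (globHom_ext fun s t => ?_)
    have := MDSpace.congr_map h2 (globPt (iToDisk s) t)
    change d.map ((attInr g).map (globPt (diskToI (iToDisk s)) t)) =
      d'.map ((attInr g).map (globPt (diskToI (iToDisk s)) t)) at this
    rwa [diskToI_iToDisk] at this

theorem FiniteAttachment.attachInterval {X : MDSpace} (h : FiniteAttachment X B) :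
    FiniteAttachment X (attachInterval g) :=
  (h.snoc (parInl g) ⟨0, _, _, pushout_isPushout _ _⟩).snoc _ (isCellAttachment_parToAtt g)

end AttachInterval

/-! ### Monotone functions along directed paths -/

theorem dblL_eq {a b : I} (h : 2 * (a : ℝ) = b) : dblL a = b := by
  rw [dblL, h, Set.projIcc_val]

theorem dblR_eq {a b : I} (h : 2 * (a : ℝ) - 1 = b) : dblR a = b := by
  rw [dblR, h, Set.projIcc_val]

theorem monotone_trans {X : Type*} [TopologicalSpace X] {x y z : X} {p : Path x y} {q : Path y z}
    {h : X → I} (hp : Monotone fun t => h (p t)) (hq : Monotone fun t => h (q t)) :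
    Monotone fun t => h (p.trans q t) := by
  intro a b hab
  have hab' : (a : ℝ) ≤ b := hab
  dsimp only
  rcases le_total (b : ℝ) (1 / 2) with hb | hb
  · rw [trans_eq_left _ _ hb, trans_eq_left _ _ (hab'.trans hb)]
    exact hp (dblL_mono hab)
  rcases le_total (a : ℝ) (1 / 2) with ha | ha
  · rw [trans_eq_left _ _ ha, trans_eq_right _ _ hb]
    have h1 : h (p (dblL a)) ≤ h (p 1) := hp le_one'
    have h2 : h (q 0) ≤ h (q (dblR b)) := hq nonneg'
    rw [p.target] at h1
    rw [q.source] at h2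
    exact h1.trans h2
  · rw [trans_eq_right _ _ ha, trans_eq_right _ _ hb]
    exact hq (dblR_mono hab)

theorem MooreChain.monotoneOn {X : MDSpace} {h : X.carrier → I}
    (hX : ∀ {x y : X.carrier} (p : Path x y), p ∈ X.exec x y → Monotone fun t => h (p t))
    {γ : I → X.carrier} {a b : I} (hγ : MooreChain X γ a b) :
    MonotoneOn (fun t => h (γ t)) (Set.Icc a b) := by
  induction hγ with
  | piece hab e he φ hm hc hφ =>
    intro s hs t ht hst
    dsimp only
    rw [hφ s hs, hφ t ht]
    exact hX e he (hm hst)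
  | comp h1 h2 ih1 ih2 =>
    rw [← Set.Icc_union_Icc_eq_Icc h1.lt.le h2.lt.le]
    exact ih1.union_right ih2 (isGreatest_Icc h1.lt.le) (isLeast_Icc h2.lt.le)

theorem IsDirectedPath.monotone {X : MDSpace} {h : X.carrier → I}
    (hX : ∀ {x y : X.carrier} (p : Path x y), p ∈ X.exec x y → Monotone fun t => h (p t))
    {x y : X.carrier} {γ : Path x y} (hγ : IsDirectedPath X γ) : Monotone fun t => h (γ t) := by
  rcases hγ with hγ | hγ
  · intro s t _
    dsimp only
    rw [hγ, hγ t]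
  · intro s t hst
    exact hγ.monotoneOn hX ⟨nonneg', le_one'⟩ ⟨nonneg', le_one'⟩ hst

/-! ### The realization of the example -/

/-- The initial vertices of the edges of `exampleSet`. -/
def exSrc : Fin 4 → Fin 4 := ![0, 1, 2, 1]

/-- The final vertices of the edges of `exampleSet`. -/
def exTgt : Fin 4 → Fin 4 := ![1, 2, 3, 2]

/-- The tame realization of `exampleSet`. -/
def exB : MDSpace := realization exSrc exTgt

/-- The universal property of `exB`. -/
def exTame : TameRealization exampleSet exB :=
  realizationTame exSrc exTgt

/-- The vertices of `exB`. -/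
def exVert (v : Fin 4) : exB.carrier := exTame.vert v

/-- The edge `d₁`. -/
def exD₁ : Path (exVert 0) (exVert 1) := exTame.edge (0 : Fin 4)

/-- The edge `d₂`. -/
def exD₂ : Path (exVert 1) (exVert 2) := exTame.edge (1 : Fin 4)

/-- The edge `d₃`. -/
def exD₃ : Path (exVert 2) (exVert 3) := exTame.edge (2 : Fin 4)

/-- The edge `d₄`. -/
def exD₄ : Path (exVert 1) (exVert 2) := exTame.edge (3 : Fin 4)

theorem exB_edge_cases {P : exB.carrier → Prop} (h₁ : ∀ t, P (exD₁ t)) (h₂ : ∀ t, P (exD₂ t))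
    (h₃ : ∀ t, P (exD₃ t)) (h₄ : ∀ t, P (exD₄ t)) (x : exB.carrier) : P x := by
  have key : ∀ e : Fin 4, ∀ t, P (exTame.edge e t) := by
    intro e
    fin_cases e
    exacts [h₁, h₂, h₃, h₄]
  obtain ⟨v, rfl⟩ | ⟨e, t, rfl⟩ :=
    realization_cases exSrc exTgt x
  · change P (exVert v)
    fin_cases v
    · simpa using h₁ 0
    · simpa using h₁ 1
    · simpa using h₂ 1
    · simpa using h₃ 1
  · exact key e t

/-- The heights of the vertices, chosen such that the height of `d₁ *_N d₂ *_N d₃` at time `t`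
is `t`. -/
def vertHeight : Fin 4 → I :=
  ![0, ⟨1 / 4, by norm_num, by norm_num⟩, ⟨1 / 2, half_mem_I⟩, 1]

/-- The height function, which is affine on the edges. -/
def exHeight : C(exB.carrier, I) :=
  realizationDesc vertHeight
    (fun e => ⟨fun t => lerp (vertHeight (exSrc e)) (vertHeight (exTgt e)) t,
      continuous_lerp continuous_const continuous_const continuous_id⟩)
    (fun _ => lerp_zero _ _) fun _ => lerp_one _ _

/-- The function which distinguishes the two edges from `1` to `2`: it is negative inside `d₂`,
positive inside `d₄`, and vanishes on `d₁` and `d₃`. -/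
def exSide : C(exB.carrier, ℝ) :=
  realizationDesc (fun _ => 0)
    (fun e => ⟨fun t => (![0, -1, 0, 1] : Fin 4 → ℝ) e * (4 * (t * (1 - t))), by fun_prop⟩)
    (fun _ => by simp) fun _ => by simp

theorem exHeight_vert (v : Fin 4) : exHeight (exVert v) = vertHeight v := rfl

theorem exHeight_D₁ (t : I) : (exHeight (exD₁ t) : ℝ) = t / 4 := by
  change (1 - (t : ℝ)) * 0 + t * (1 / 4) = _
  ring

theorem exHeight_D₂ (t : I) : (exHeight (exD₂ t) : ℝ) = (1 + t) / 4 := by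
  change (1 - (t : ℝ)) * (1 / 4) + t * (1 / 2) = _
  ring

theorem exHeight_D₃ (t : I) : (exHeight (exD₃ t) : ℝ) = (1 + t) / 2 := by
  change (1 - (t : ℝ)) * (1 / 2) + t * 1 = _
  ring

theorem exHeight_D₄ (t : I) : (exHeight (exD₄ t) : ℝ) = (1 + t) / 4 := by
  change (1 - (t : ℝ)) * (1 / 4) + t * (1 / 2) = _
  ring

theorem exSide_D₁ (t : I) : exSide (exD₁ t) = 0 := zero_mul _

theorem exSide_D₂ (t : I) : exSide (exD₂ t) = -(4 * (t * (1 - t))) := neg_one_mul _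

theorem exSide_D₃ (t : I) : exSide (exD₃ t) = 0 := zero_mul _

theorem exSide_D₄ (t : I) : exSide (exD₄ t) = 4 * (t * (1 - t)) := one_mul _

theorem exHeight_of_exSide_ne {x : exB.carrier} (h : exSide x ≠ 0) :
    1 / 4 < (exHeight x : ℝ) ∧ (exHeight x : ℝ) < 1 / 2 := by
  have key (t : I) (h : (t : ℝ) * (1 - t) ≠ 0) : 1 / 4 < (1 + (t : ℝ)) / 4 ∧
      (1 + (t : ℝ)) / 4 < 1 / 2 := by
    have h0 := t.2.1.lt_of_ne' (left_ne_zero_of_mul h)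
    have h1 := t.2.2.lt_of_ne fun h' => h (by rw [h']; ring)
    constructor <;> linarith
  induction x using exB_edge_cases with
  | h₁ t =>
    exact absurd (exSide_D₁ t) h
  | h₂ t =>
    rw [exHeight_D₂]
    rw [exSide_D₂] at h
    exact key t fun h' => h (by rw [h']; ring)
  | h₃ t =>
    exact absurd (exSide_D₃ t) h
  | h₄ t =>
    rw [exHeight_D₄]
    rw [exSide_D₄] at h
    exact key t fun h' => h (by rw [h']; ring)

theorem exSide_ne_of_exHeight {x : exB.carrier} (h1 : 1 / 4 < (exHeight x : ℝ))
    (h2 : (exHeight x : ℝ) < 1 / 2) : exSide x ≠ 0 := by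
  have key (t : I) (h1 : 1 / 4 < (1 + (t : ℝ)) / 4) (h2 : (1 + (t : ℝ)) / 4 < 1 / 2) :
      0 < 4 * ((t : ℝ) * (1 - t)) := by
    have := mul_pos (show 0 < (t : ℝ) by linarith) (show 0 < 1 - (t : ℝ) by linarith)
    linarith
  induction x using exB_edge_cases with
  | h₁ t =>
    rw [exHeight_D₁] at h1
    linarith [t.2.2]
  | h₂ t =>
    rw [exHeight_D₂] at h1 h2
    rw [exSide_D₂]
    exact neg_ne_zero.2 (key t h1 h2).ne'
  | h₃ t =>
    rw [exHeight_D₃] at h2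
    linarith [t.2.1]
  | h₄ t =>
    rw [exHeight_D₄] at h1 h2
    rw [exSide_D₄]
    exact (key t h1 h2).ne'

theorem four_mul_le_one (t : ℝ) : 4 * (t * (1 - t)) ≤ 1 := by nlinarith [sq_nonneg (2 * t - 1)]

theorem exSide_le_one (x : exB.carrier) : exSide x ≤ 1 := by
  induction x using exB_edge_cases with
  | h₁ t =>
    rw [exSide_D₁]; norm_num
  | h₂ t =>
    rw [exSide_D₂]
    have := mul_nonneg t.2.1 (sub_nonneg.2 t.2.2)
    linarith
  | h₃ t =>
    rw [exSide_D₃]; norm_num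
  | h₄ t =>
    rw [exSide_D₄]; exact four_mul_le_one t

theorem exSide_of_exHeight_eq {x : exB.carrier} (h : (exHeight x : ℝ) = 3 / 8)
    (h' : 0 ≤ exSide x) : exSide x = 1 := by
  induction x using exB_edge_cases with
  | h₁ t =>
    rw [exHeight_D₁] at h
    linarith [t.2.2]
  | h₂ t =>
    rw [exHeight_D₂] at h
    rw [exSide_D₂, show (t : ℝ) = 1 / 2 by linarith] at h'
    norm_num at h'
  | h₃ t =>
    rw [exHeight_D₃] at h
    linarith [t.2.1]
  | h₄ t =>
    rw [exHeight_D₄] at h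
    rw [exSide_D₄, show (t : ℝ) = 1 / 2 by linarith]
    norm_num

/-- The path from `0` to `3` through the path `m` from `1` to `2`. -/
def exVia (m : Path (exVert 1) (exVert 2)) : Path (exVert 0) (exVert 3) :=
  (exD₁.trans m).trans exD₃

section Via

variable (m : Path (exVert 1) (exVert 2))

theorem exVia_D₁ (t : I) : exVia m (exHeight (exD₁ t)) = exD₁ t := by
  have ht : 0 ≤ (t : ℝ) ∧ (t : ℝ) ≤ 1 := t.2
  have h := exHeight_D₁ t
  have h1 : dblL (exHeight (exD₁ t)) = ⟨t / 2, halfL_mem t⟩ :=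
    dblL_eq (by rw [h]; ring)
  rw [exVia, trans_eq_left _ _ (by rw [h]; linarith [ht.2]), h1,
    trans_eq_left _ _ (by change (t : ℝ) / 2 ≤ _; linarith [ht.2]), dblL_mk]

theorem exVia_D₃ (t : I) : exVia m (exHeight (exD₃ t)) = exD₃ t := by
  have ht : 0 ≤ (t : ℝ) ∧ (t : ℝ) ≤ 1 := t.2
  have h := exHeight_D₃ t
  have h1 : dblR (exHeight (exD₃ t)) = t := dblR_eq (by rw [h]; ring)
  rw [exVia, trans_eq_right _ _ (by rw [h]; linarith [ht.1]), h1]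

theorem exVia_mid {s t : I} (h : (s : ℝ) = (1 + t) / 4) : exVia m s = m t := by
  have ht : 0 ≤ (t : ℝ) ∧ (t : ℝ) ≤ 1 := t.2
  have h1 : dblL s = ⟨(1 + t) / 2, halfR_mem t⟩ :=
    dblL_eq (by rw [h]; ring)
  rw [exVia, trans_eq_left _ _ (by rw [h]; linarith [ht.2]), h1,
    trans_eq_right _ _ (by change 1 / 2 ≤ (1 + (t : ℝ)) / 2; linarith [ht.1]), dblR_mk]

theorem exHeight_exVia (hm : ∀ t, (exHeight (m t) : ℝ) = (1 + t) / 4) (t : I) :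
    exHeight (exVia m t) = t := by
  have ht : 0 ≤ (t : ℝ) ∧ (t : ℝ) ≤ 1 := t.2
  refine Subtype.ext ?_
  rcases le_total (t : ℝ) (1 / 2) with h | h
  · have h0 : (2 * (t : ℝ)) ∈ I := by constructor <;> linarith [ht.1]
    rw [exVia, trans_eq_left _ _ h, dblL_eq (b := ⟨_, h0⟩) rfl]
    rcases le_total (t : ℝ) (1 / 4) with h' | h'
    · have h1 : (4 * (t : ℝ)) ∈ I := by constructor <;> linarith [ht.1]
      rw [trans_eq_left _ _ (by change 2 * (t : ℝ) ≤ _; linarith),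
        dblL_eq (b := ⟨_, h1⟩) (by ring), exHeight_D₁]
      change 4 * (t : ℝ) / 4 = t
      ring
    · have h1 : (4 * (t : ℝ) - 1) ∈ I := by constructor <;> linarith [ht.1]
      rw [trans_eq_right _ _ (by change _ ≤ 2 * (t : ℝ); linarith),
        dblR_eq (b := ⟨_, h1⟩) (by ring), hm]
      change (1 + (4 * (t : ℝ) - 1)) / 4 = t
      ring
  · have h1 : (2 * (t : ℝ) - 1) ∈ I := by constructor <;> linarith [ht.2]
    rw [exVia, trans_eq_right _ _ h, dblR_eq (b := ⟨_, h1⟩) rfl, exHeight_D₃]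
    change (1 + (2 * (t : ℝ) - 1)) / 2 = t
    ring

end Via

theorem eq_zero_or_one_of_mul {t : I} (h : (t : ℝ) * (1 - t) ≤ 0) : t = 0 ∨ t = 1 := by
  have h' := le_antisymm h (mul_nonneg t.2.1 (sub_nonneg.2 t.2.2))
  rcases mul_eq_zero.1 h' with h | h
  · exact .inl (Subtype.ext h)
  · exact .inr (Subtype.ext (by change (t : ℝ) = 1; linarith))

theorem exVia_D₂_of_exSide {x : exB.carrier} (h : exSide x ≤ 0) :
    exVia exD₂ (exHeight x) = x := by
  induction x using exB_edge_cases with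
  | h₁ t => exact exVia_D₁ _ t
  | h₂ t => exact exVia_mid _ (exHeight_D₂ t)
  | h₃ t => exact exVia_D₃ _ t
  | h₄ t =>
    rw [exSide_D₄] at h
    rw [exVia_mid _ (exHeight_D₄ t)]
    obtain rfl | rfl := eq_zero_or_one_of_mul (t := t) (by linarith) <;> simp

theorem exVia_D₄_of_exSide {x : exB.carrier} (h : 0 ≤ exSide x) :
    exVia exD₄ (exHeight x) = x := by
  induction x using exB_edge_cases with
  | h₁ t => exact exVia_D₁ _ t
  | h₂ t =>
    rw [exSide_D₂] at h
    rw [exVia_mid _ (exHeight_D₂ t)]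
    obtain rfl | rfl := eq_zero_or_one_of_mul (t := t) (by linarith) <;> simp
  | h₃ t => exact exVia_D₃ _ t
  | h₄ t => exact exVia_mid _ (exHeight_D₄ t)

theorem exHeight_exVia_D₂ (t : I) : exHeight (exVia exD₂ t) = t :=
  exHeight_exVia _ exHeight_D₂ t

theorem exHeight_exVia_D₄ (t : I) : exHeight (exVia exD₄ t) = t :=
  exHeight_exVia _ exHeight_D₄ t

theorem exSide_exVia_D₂ (t : I) : exSide (exVia exD₂ t) ≤ 0 := by
  by_contra! h
  obtain ⟨h1, h2⟩ := exHeight_of_exSide_ne h.ne'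
  rw [exHeight_exVia_D₂] at h1 h2
  have hs : 4 * (t : ℝ) - 1 ∈ I := by constructor <;> linarith
  rw [exVia_mid exD₂ (t := ⟨_, hs⟩) (by change _ = (1 + (4 * (t : ℝ) - 1)) / 4; ring),
    exSide_D₂] at h
  have := mul_nonneg hs.1 (sub_nonneg.2 hs.2)
  dsimp only at h
  linarith

theorem exSide_exVia_D₄ (t : I) : 0 ≤ exSide (exVia exD₄ t) := by
  by_contra! h
  obtain ⟨h1, h2⟩ := exHeight_of_exSide_ne h.ne
  rw [exHeight_exVia_D₄] at h1 h2
  have hs : 4 * (t : ℝ) - 1 ∈ I := by constructor <;> linarith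
  rw [exVia_mid exD₄ (t := ⟨_, hs⟩) (by change _ = (1 + (4 * (t : ℝ) - 1)) / 4; ring),
    exSide_D₄] at h
  have := mul_nonneg hs.1 (sub_nonneg.2 hs.2)
  dsimp only at h
  linarith

/-- A path of non-decreasing height does not enter both edges from `1` to `2`: between two
points of these edges it would stay over the open interval of heights `]1/4, 1/2[`, where `exSide`
does not vanish. -/
theorem exSide_nonpos_or_nonneg {x y : exB.carrier} (q : Path x y)
    (hq : Monotone fun t => exHeight (q t)) :
    (∀ t, exSide (q t) ≤ 0) ∨ ∀ t, 0 ≤ exSide (q t) := by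
  by_contra! h
  obtain ⟨⟨a, ha⟩, b, hb⟩ := h
  have hc : Continuous fun t => exSide (q t) := by fun_prop
  obtain ⟨s, hs, h0⟩ := intermediate_value_uIcc hc.continuousOn
    (show (0 : ℝ) ∈ Set.uIcc (exSide (q a)) (exSide (q b)) from
      Set.mem_uIcc.2 (.inr ⟨hb.le, ha.le⟩))
  obtain ⟨ha1, ha2⟩ := exHeight_of_exSide_ne ha.ne'
  obtain ⟨hb1, hb2⟩ := exHeight_of_exSide_ne hb.ne
  have hle {u v : I} (huv : u ≤ v) : (exHeight (q u) : ℝ) ≤ exHeight (q v) := hq huv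
  rcases Set.mem_uIcc.1 hs with hs | hs
  · exact exSide_ne_of_exHeight (ha1.trans_le (hle hs.1)) ((hle hs.2).trans_lt hb2) h0
  · exact exSide_ne_of_exHeight (hb1.trans_le (hle hs.1)) ((hle hs.2).trans_lt ha2) h0

/-- The part of `exSide` supported on `d₄`. -/
def exAlt : C(exB.carrier, ℝ) := ⟨fun x => max (exSide x) 0, by fun_prop⟩

theorem norm_exAlt_eq_zero {x y : exB.carrier} {q : Path x y} (h : ∀ t, exSide (q t) ≤ 0) :
    ‖exAlt.comp q.toContinuousMap‖ = 0 :=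
  norm_eq_zero.2 (ContinuousMap.ext fun t => max_eq_right (h t))

/-- A path on which `exSide` is non-negative and which crosses the heights between `1/4` and `1/2`
meets the middle of `d₄`, where `exSide` takes its maximal value. -/
theorem norm_exAlt_eq_one {x y : exB.carrier} {q : Path x y} (h : ∀ t, 0 ≤ exSide (q t))
    (hx : (exHeight x : ℝ) ≤ 1 / 4) (hy : 1 / 2 ≤ (exHeight y : ℝ)) :
    ‖exAlt.comp q.toContinuousMap‖ = 1 := by
  refine le_antisymm ?_ ?_
  · refine (ContinuousMap.norm_le _ zero_le_one).2 fun t => ?_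
    change |max (exSide (q t)) 0| ≤ 1
    rw [max_eq_left (h t), abs_of_nonneg (h t)]
    exact exSide_le_one _
  · have hc : Continuous fun t => exHeight (q t) := by fun_prop
    obtain ⟨s, hs⟩ := intermediate_value_univ 0 1 hc
      (show (⟨3 / 8, by norm_num, by norm_num⟩ : I) ∈ _ by
        rw [q.source, q.target]
        constructor
        · change (exHeight x : ℝ) ≤ 3 / 8; linarith
        · change 3 / 8 ≤ (exHeight y : ℝ); linarith)
    refine le_of_eq_of_le ?_ ((exAlt.comp q.toContinuousMap).norm_coe_le_norm s)
    change 1 = |max (exSide (q s)) 0|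
    rw [exSide_of_exHeight_eq (congrArg Subtype.val hs) (h s)]
    norm_num

theorem exVia_cases {x y : exB.carrier} (q : Path x y)
    (hq : Monotone fun t => exHeight (q t)) (hx : (exHeight x : ℝ) ≤ 1 / 4)
    (hy : 1 / 2 ≤ (exHeight y : ℝ)) :
    (‖exAlt.comp q.toContinuousMap‖ = 0 ∧ ∀ t, exVia exD₂ (exHeight (q t)) = q t) ∨
      (‖exAlt.comp q.toContinuousMap‖ = 1 ∧ ∀ t, exVia exD₄ (exHeight (q t)) = q t) :=
  (exSide_nonpos_or_nonneg q hq).imp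
    (fun h => ⟨norm_exAlt_eq_zero h, fun t => exVia_D₂_of_exSide (h t)⟩)
    fun h => ⟨norm_exAlt_eq_one h hx hy, fun t => exVia_D₄_of_exSide (h t)⟩

theorem exB_exec {x y : exB.carrier} {p : Path x y} (hp : p ∈ exB.exec x y) :
    (Monotone fun t => exHeight (p t)) ∧ exHeight x < exHeight y := by
  induction hp with
  | @of x y p h =>
    obtain ⟨e, he⟩ := h
    have key : vertHeight (exSrc e) < vertHeight (exTgt e) := by
      clear he
      fin_cases e
      · exact Subtype.mk_lt_mk.2 (by norm_num)
      · exact Subtype.mk_lt_mk.2 (by norm_num)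
      · exact Subtype.mk_lt_mk.2 (by norm_num)
      · exact Subtype.mk_lt_mk.2 (by norm_num)
    have hh : ∀ t, exHeight (p t) =
      lerp (vertHeight (exSrc e)) (vertHeight (exTgt e)) t := fun t => by
        rw [he]; rfl
    refine ⟨fun s t hst => ?_, ?_⟩
    · have hst' : (s : ℝ) ≤ t := hst
      have key' : (vertHeight (exSrc e) : ℝ) < vertHeight (exTgt e) := key
      dsimp only
      rw [hh, hh]
      refine Subtype.mk_le_mk.2 ?_
      nlinarith
    · have h0 := hh 0
      have h1 := hh 1
      rw [p.source, lerp_zero] at h0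
      rw [p.target, lerp_one] at h1
      rwa [h0, h1]
  | reparam φ hφ h _ ih =>
    refine ⟨fun s t hst => ?_, ih.2⟩
    dsimp only
    rw [h, h]
    exact ih.1 (hφ.1 hst)
  | trans _ _ ih ih' => exact ⟨monotone_trans ih.1 ih'.1, ih.2.trans ih'.2⟩

/-! ### The globe attached to the example -/

theorem deltaGenerated_square : DeltaGeneratedSpace (I × I) :=
  have := deltaGenerated_cube_prod 1
  ((Homeomorph.funUnique (Fin 1) I).prodCongr (Homeomorph.refl I)).isQuotientMap.isGeneratedBy

theorem exVia_mem {m : Path (exVert 1) (exVert 2)} (hm : m ∈ exB.exec _ _) :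
    exVia m ∈ exB.exec _ _ :=
  exB.exec_trans (exB.exec_trans (exTame.edge_mem (0 : Fin 4)) hm) (exTame.edge_mem (2 : Fin 4))

theorem exD₂_mem : exD₂ ∈ exB.exec _ _ := exTame.edge_mem (1 : Fin 4)

theorem exD₄_mem : exD₄ ∈ exB.exec _ _ := exTame.edge_mem (3 : Fin 4)

/-- The execution path `d₁ *_N d₂ *_N d₃`, as a map out of a globe. -/
def exG : glob PUnit ⟶ exB := globHomOfPath PUnit (exVia exD₂) (exVia_mem exD₂_mem)

/-- The result of attaching `Glob([0,1])` to `exB` along `exG`. -/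
def exA : MDSpace := attachInterval exG

/-- The inclusion of `exB` in `exA`. -/
def exI : exB ⟶ exA := attInl exG

/-- The added globe. -/
def exC : glob I ⟶ exA := attInr exG

/-- The point `(z,t)` of the added globe. -/
def exPt (z t : I) : exA.carrier := exC.map (globPt z t)

/-- The retraction of `exA` onto `exB` which collapses the added globe. -/
def exF : exA ⟶ exB :=
  pushDesc (𝟙 exB) (globMap (ContinuousMap.const I PUnit.unit) ≫ exG) (globHom_ext fun _ _ => rfl)

theorem exF_exI (x : exB.carrier) : exF.map (exI.map x) = x := rfl

theorem exF_exPt (z t : I) : exF.map (exPt z t) = exVia exD₂ t := rfl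

theorem exPt_zero_left (t : I) : exPt 0 t = exI.map (exVia exD₂ t) := (att_glue exG t).symm

theorem exPt_zero_right (z : I) : exPt z 0 = exI.map (exVert 0) := by
  rw [exPt, globPt_zero, ← globPt_zero 0, ← (exVia exD₂).source]
  exact exPt_zero_left 0

theorem exPt_one_right (z : I) : exPt z 1 = exI.map (exVert 3) := by
  rw [exPt, globPt_one, ← globPt_one 0, ← (exVia exD₂).target]
  exact exPt_zero_left 1

theorem continuous_exPt : Continuous fun s : I × I => exPt s.1 s.2 :=
  have := deltaGenerated_square
  exC.map.continuous.comp continuous_globPt_prod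

/-- The function on `exA` which vanishes on `exB` and takes the value `4zt(1-t)` at the point
`(z,t)` of the added globe: its maximum along an execution path is the parameter `z` of this
path. -/
def exBump : C(exA.carrier, ℝ) :=
  pushDescMap (ContinuousMap.const _ 0)
    (globDesc (fun _ => 0) ⟨fun s : I × I => s.1 * (4 * (s.2 * (1 - s.2))), by fun_prop⟩
      (fun _ => by simp) fun _ => by simp)
    (fun x => by
      obtain ⟨z, t, rfl⟩ := glob_cases_of_nonempty x
      exact (zero_mul _).symm)

theorem exBump_exI (x : exB.carrier) : exBump (exI.map x) = 0 := rfl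

theorem exBump_exPt (z t : I) : exBump (exPt z t) = z * (4 * (t * (1 - t))) := rfl

/-- The height function of `exA`. -/
def exTime : C(exA.carrier, I) := exHeight.comp exF.map

theorem exTime_exPt (z t : I) : exTime (exPt z t) = t := exHeight_exVia_D₂ t

/-- An execution path of `exA` lies in `exB`, or runs along the added globe. -/
theorem exA_exec {x y : exA.carrier} {p : Path x y} (hp : p ∈ exA.exec x y) :
    (∃ (x' y' : exB.carrier) (q : Path x' y'), q ∈ exB.exec x' y' ∧ ∀ t, p t = exI.map (q t)) ∨
      ((x = exI.map (exVert 0) ∧ y = exI.map (exVert 3)) ∧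
        ∃ (z : I) (φ : I → I), IsReparam φ ∧ ∀ t, p t = exPt z (φ t)) := by
  have hinj {u v : exB.carrier} (h : exI.map u = exI.map v) : u = v := congrArg exF.map h
  induction hp with
  | of p h =>
    rcases h with ⟨x', y', q, hq, h⟩ | ⟨x', y', q, ⟨z, φ, hφ, hq⟩, h⟩
    · exact .inl ⟨x', y', q, hq, h⟩
    · have h' : ∀ t, p t = exPt z (φ t) := fun t => (h t).trans
        (congrArg exC.map (hq t))
      refine .inr ⟨⟨?_, ?_⟩, z, φ, hφ, h'⟩
      · rw [← p.source, h', hφ.zero, exPt_zero_right]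
      · rw [← p.target, h', hφ.one, exPt_one_right]
  | @reparam x y p p' ψ hψ h _ ih =>
    rcases ih with ⟨x', y', q, hq, h'⟩ | ⟨hxy, z, φ, hφ, h'⟩
    · refine .inl ⟨x', y', (⟨⟨fun t => q (ψ t), q.continuous.comp hψ.continuous⟩, ?_, ?_⟩ :
        Path x' y'), ?_, fun t => ?_⟩
      · change q (ψ 0) = x'
        rw [hψ.zero, q.source]
      · change q (ψ 1) = y'
        rw [hψ.one, q.target]
      · exact exB.exec_reparam hq ψ hψ _ fun _ => rfl
      · rw [h, h']; rfl
    · exact .inr ⟨hxy, z, fun t => φ (ψ t), hφ.comp hψ, fun t => by rw [h, h']⟩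
  | @trans x y w p p' _ _ ih ih' =>
    rcases ih with ⟨x', y', q, hq, h⟩ | ⟨⟨rfl, rfl⟩, -⟩ <;>
    rcases ih' with ⟨y'', w', q', hq', h'⟩ | ⟨⟨h0, rfl⟩, -⟩
    · have hy : exI.map y' = y := by rw [← p.target, h, q.target]
      have hy' : exI.map y'' = y := by rw [← p'.source, h', q'.source]
      obtain rfl : y' = y'' := hinj (hy.trans hy'.symm)
      refine .inl ⟨x', w', q.trans q', exB.exec_trans hq hq', fun t => ?_⟩
      rcases le_total (t : ℝ) (1 / 2) with ht | ht
      · rw [trans_eq_left _ _ ht, trans_eq_left _ _ ht, h]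
      · rw [trans_eq_right _ _ ht, trans_eq_right _ _ ht, h']
    -- no execution path of `exB` ends at the initial vertex
    · have hy : exI.map y' = exI.map (exVert 0) := by rw [← h0, ← p.target, h, q.target]
      have h1 := (exB_exec hq).2
      rw [hinj hy] at h1
      exact absurd h1 (not_lt.2 nonneg')
    -- no execution path of `exB` starts from the final vertex
    · have hy : exI.map y'' = exI.map (exVert 3) := by rw [← p'.source, h', q'.source]
      have h1 := (exB_exec hq').2
      rw [hinj hy] at h1
      exact absurd h1 (not_lt.2 le_one')
    · exact absurd (congrArg exHeight (hinj h0)) (by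
        rw [exHeight_vert, exHeight_vert]
        exact one_ne_zero)

theorem exTime_exec {x y : exA.carrier} {p : Path x y} (hp : p ∈ exA.exec x y) :
    Monotone fun t => exTime (p t) :=
  (exB_exec (exF.map_exec p hp)).1

/-! ### The retraction is a trivial fibration -/

theorem exA_states {x : exA.carrier} (hx : x ∈ exA.states) :
    ∃ a ∈ exB.states, x = exI.map a := by
  obtain ⟨a, ha, rfl⟩ | ⟨_, ⟨b, rfl⟩, rfl⟩ := hx
  · exact ⟨a, ha, rfl⟩
  · cases b
    · refine ⟨exVert 0, exTame.vert_mem _, ?_⟩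
      rw [← exPt_zero_right 0, exPt, globPt_zero]
      rfl
    · refine ⟨exVert 3, exTame.vert_mem _, ?_⟩
      rw [← exPt_one_right 0, exPt, globPt_one]
      rfl

theorem exF_bijOn : Set.BijOn exF.map exA.states exB.states := by
  refine ⟨fun x hx => exF.map_states x hx, fun x hx y hy h => ?_, fun a ha =>
    ⟨exI.map a, exI.map_states a ha, rfl⟩⟩
  obtain ⟨a, -, rfl⟩ := exA_states hx
  obtain ⟨b, -, rfl⟩ := exA_states hy
  exact congrArg exI.map h

theorem kel_ext {X : Type*} [TopologicalSpace X] {x y : Kel X} (h : ofKel x = ofKel y) : x = y :=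
  Topology.WithGeneratedByTopology.equiv.injective h

theorem kel_exec_ext {X : MDSpace} {x y : X.carrier} {p q : X.ExecSpace x y}
    (h : ∀ t, (ofKel p).1 t = (ofKel q).1 t) : p = q :=
  kel_ext (Subtype.ext (Path.ext (funext h)))

/-- Between states for which there are no execution paths along the added globe, the spaces of
execution paths of `exA` and of `exB` are homeomorphic. -/
def execFibrationOfNe (a b : exB.carrier) (h : ¬ (a = exVert 0 ∧ b = exVert 3)) :
    IntervalFibration (MDSpace.execMap exF (exI.map a) (exI.map b)) :=
  .ofInverse (MDSpace.execMap exI a b) (fun q => kel_exec_ext (p := MDSpace.execMap exF _ _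
    (MDSpace.execMap exI a b q)) (q := q) fun t => rfl) (fun p => kel_exec_ext fun t => by
      obtain ⟨x', y', q, -, hq⟩ | ⟨hxy, -⟩ := exA_exec (ofKel p).2
      · change exI.map (exF.map ((ofKel p).1 t)) = _
        rw [hq, exF_exI]
      · exact absurd ⟨congrArg exF.map hxy.1, congrArg exF.map hxy.2⟩ h)

/-- The maximum of a continuous function along an execution path depends continuously on the
path. -/
theorem continuous_norm_comp {X : Type*} [TopologicalSpace X] {x y : X} (h : C(X, ℝ)) :
    Continuous fun p : Path x y => ‖h.comp p.toContinuousMap‖ :=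
  continuous_norm.comp ((ContinuousMap.continuous_postcomp h).comp continuous_induced_dom)

theorem isReparam_exHeight {q : Path (exVert 0) (exVert 3)} (hq : q ∈ exB.exec _ _) :
    IsReparam fun t => exHeight (q t) :=
  .of (exB_exec hq).1 (by fun_prop) (by rw [q.source]; rfl) (by rw [q.target]; rfl)

/-- The execution path of parameter `z` of the added globe, with the same reparametrization as
`q`. -/
def globLift (q : exB.exec (exVert 0) (exVert 3)) (z : I) :
    exA.exec (exI.map (exVert 0)) (exI.map (exVert 3)) :=
  ⟨{ toFun := fun t => exPt z (exHeight (q.1 t))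
     continuous_toFun := continuous_exPt.comp (continuous_const.prodMk (by fun_prop))
     source' := by rw [q.1.source]; exact exPt_zero_right z
     target' := by rw [q.1.target]; exact exPt_one_right z }, by
    have h := isReparam_exHeight q.2
    let r : Path (globState false : (glob I).carrier) (globState true) :=
      { toFun := fun t => globPt z (exHeight (q.1 t))
        continuous_toFun := (continuous_globPt z).comp h.continuous
        source' := by rw [h.zero, globPt_zero]
        target' := by rw [h.one, globPt_one] }
    exact exA.exec_congr (exC.map_exec r ⟨z, _, h, fun _ => rfl⟩) fun _ => rfl⟩

theorem continuous_globLift :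
    Continuous fun s : exB.exec (exVert 0) (exVert 3) × I => globLift s.1 s.2 := by
  refine Continuous.subtype_mk (continuous_induced_rng.2
    (ContinuousMap.continuous_of_continuous_uncurry _ ?_)) _
  have h : Continuous fun s : (exB.exec (exVert 0) (exVert 3) × I) × I =>
      s.1.1.1.toContinuousMap :=
    continuous_induced_dom.comp (continuous_subtype_val.comp (continuous_fst.comp continuous_fst))
  exact continuous_exPt.comp ((continuous_snd.comp continuous_fst).prodMk
    (exHeight.continuous.comp (h.eval continuous_snd)))

theorem exVia_cases_exec {q : Path (exVert 0) (exVert 3)} (hq : q ∈ exB.exec _ _) :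
    (‖exAlt.comp q.toContinuousMap‖ = 0 ∧ ∀ t, exVia exD₂ (exHeight (q t)) = q t) ∨
      (‖exAlt.comp q.toContinuousMap‖ = 1 ∧ ∀ t, exVia exD₄ (exHeight (q t)) = q t) :=
  exVia_cases q (exB_exec hq).1 (by rw [exHeight_vert]; change (0 : ℝ) ≤ _; norm_num)
    (by rw [exHeight_vert]; change _ ≤ (1 : ℝ); norm_num)

theorem norm_exBump_le {x y : exA.carrier} (p : Path x y) :
    ‖exBump.comp p.toContinuousMap‖ ≤ 1 := by
  refine (ContinuousMap.norm_le _ zero_le_one).2 fun t => ?_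
  change |exBump (p t)| ≤ 1
  generalize p t = a
  obtain ⟨a, rfl⟩ | ⟨b, rfl⟩ := push_cases exG (globMap (ContinuousMap.const PUnit (0 : I))) a
  · change |(0 : ℝ)| ≤ 1
    norm_num
  · obtain ⟨z, t, rfl⟩ := glob_cases_of_nonempty b
    change |(z : ℝ) * (4 * (t * (1 - t)))| ≤ 1
    have h := mul_nonneg t.2.1 (sub_nonneg.2 t.2.2)
    rw [abs_of_nonneg (mul_nonneg z.2.1 (by linarith))]
    exact mul_le_one₀ z.2.2 (by linarith) (four_mul_le_one t)

/-- The parameter `z` of an execution path is the norm of `exBump` along it. -/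
theorem norm_exBump_exPt {x y : exA.carrier} {p : Path x y} {z : I} {φ : I → I}
    (hφ : IsReparam φ) (h : ∀ t, p t = exPt z (φ t)) : ‖exBump.comp p.toContinuousMap‖ = z := by
  refine le_antisymm ((ContinuousMap.norm_le _ z.2.1).2 fun t => ?_) ?_
  · change |exBump (p t)| ≤ z
    have h0 := mul_nonneg (φ t).2.1 (sub_nonneg.2 (φ t).2.2)
    rw [h, exBump_exPt, abs_of_nonneg (mul_nonneg z.2.1 (by linarith))]
    exact mul_le_of_le_one_right z.2.1 (four_mul_le_one _)
  · obtain ⟨t, ht⟩ := hφ.2 ⟨1 / 2, half_mem_I⟩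
    refine le_trans (le_of_eq ?_) ((exBump.comp p.toContinuousMap).norm_coe_le_norm t)
    change (z : ℝ) = |exBump (p t)|
    rw [h, exBump_exPt, ht]
    change (z : ℝ) = |(z : ℝ) * (4 * (1 / 2 * (1 - 1 / 2)))|
    norm_num
    exact (abs_of_nonneg z.2.1).symm

/-- The parameter `z` of an execution path of `exA`; it is `0` for those which lie in `exB`. -/
def execParam (x y : exA.carrier) : C(exA.ExecSpace x y, I) where
  toFun p := ⟨‖exBump.comp (ofKel p).1.toContinuousMap‖, norm_nonneg _, norm_exBump_le _⟩
  continuous_toFun := ((continuous_norm_comp exBump).comp (continuous_subtype_val.comp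
    Topology.WithGeneratedByTopology.continuous_equiv)).subtype_mk _

open Classical in
/-- The lift to `exA` of an execution path of `exB` from `0` to `3`: with the parameter `z` if it
runs through `d₂`, and the path itself if it runs through `d₄`. -/
def execLift (q : exB.ExecSpace (exVert 0) (exVert 3)) (z : I) :
    exA.ExecSpace (exI.map (exVert 0)) (exI.map (exVert 3)) :=
  if ‖exAlt.comp (ofKel q).1.toContinuousMap‖ = 0 then toKel (globLift (ofKel q) z)
  else MDSpace.execMap exI (exVert 0) (exVert 3) q

theorem execLift_apply_D₂ {q : exB.ExecSpace (exVert 0) (exVert 3)}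
    (h : ‖exAlt.comp (ofKel q).1.toContinuousMap‖ = 0) (z t : I) :
    (ofKel (execLift q z)).1 t = exPt z (exHeight ((ofKel q).1 t)) := by
  rw [execLift, if_pos h]
  rfl

theorem execLift_apply_D₄ {q : exB.ExecSpace (exVert 0) (exVert 3)}
    (h : ‖exAlt.comp (ofKel q).1.toContinuousMap‖ = 1) (z t : I) :
    (ofKel (execLift q z)).1 t = exI.map ((ofKel q).1 t) := by
  rw [execLift, if_neg (by rw [h]; exact one_ne_zero)]
  rfl

theorem continuous_execLift {D : Type} [TopologicalSpace D] [DeltaGeneratedSpace D]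
    {a : D → exB.ExecSpace (exVert 0) (exVert 3)} {s : D → I} (ha : Continuous a)
    (hs : Continuous s) : Continuous fun d => execLift (a d) (s d) := by
  have hK : Continuous fun d => ofKel (a d) :=
    Topology.WithGeneratedByTopology.continuous_equiv.comp ha
  have hn : Continuous fun d => ‖exAlt.comp (ofKel (a d)).1.toContinuousMap‖ :=
    (continuous_norm_comp exAlt).comp (continuous_subtype_val.comp hK)
  -- the norm only takes the values `0` and `1`
  have hcl : IsClopen {d | ‖exAlt.comp (ofKel (a d)).1.toContinuousMap‖ = 0} := by
    refine ⟨isClosed_eq hn continuous_const, ?_⟩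
    convert isOpen_lt hn (continuous_const (y := (1 / 2 : ℝ))) using 1
    ext d
    rcases exVia_cases_exec (ofKel (a d)).2 with h | h <;>
      simp only [Set.mem_ofPred_eq, h.1] <;> norm_num
  refine Continuous.if (fun d hd => ?_) ?_ ?_
  · rw [hcl.frontier_eq] at hd
    exact hd.elim
  · exact continuous_toKel_comp (continuous_globLift.comp (hK.prodMk hs))
  · exact (MDSpace.execMap exI (exVert 0) (exVert 3)).continuous.comp ha

/-- Over the execution paths from `0` to `3` which run through `d₂`, the fibre of `P^top f` is
the unit interval; over those which run through `d₄`, it is a point. -/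
def execFibration :
    IntervalFibration (MDSpace.execMap exF (exI.map (exVert 0)) (exI.map (exVert 3))) where
  coord := execParam _ _
  lift := execLift
  continuous_lift ha hs := continuous_execLift ha hs
  map_lift q z := by
    refine kel_exec_ext fun t => ?_
    change exF.map ((ofKel (execLift q z)).1 t) = _
    rcases exVia_cases_exec (ofKel q).2 with h | h
    · rw [execLift_apply_D₂ h.1]
      exact h.2 t
    · rw [execLift_apply_D₄ h.1]
      rfl
  lift_map p := by
    let q : exB.ExecSpace (exVert 0) (exVert 3) :=
      MDSpace.execMap exF (exI.map (exVert 0)) (exI.map (exVert 3)) p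
    have hq (t : I) : (ofKel q).1 t = exF.map ((ofKel p).1 t) := rfl
    change execLift q (execParam _ _ p) = p
    refine kel_exec_ext fun t => ?_
    rcases exA_exec (ofKel p).2 with ⟨x', y', r, -, h⟩ | ⟨-, z, φ, hφ, h⟩
    · have hr : exI.map ((ofKel q).1 t) = (ofKel p).1 t := by rw [hq, h, exF_exI]
      rcases exVia_cases_exec (ofKel q).2 with h' | h'
      · have h0 : execParam _ _ p = 0 := Subtype.ext <|
          norm_eq_zero.2 (ContinuousMap.ext fun t => (congrArg exBump (h t)).trans rfl)
        rw [execLift_apply_D₂ h'.1, h0, exPt_zero_left, h'.2, hr]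
      · rw [execLift_apply_D₄ h'.1, hr]
    · have h' : ∀ t, exSide ((ofKel q).1 t) ≤ 0 := fun t => by
        rw [hq, h, exF_exPt]
        exact exSide_exVia_D₂ _
      have h0 : ‖exAlt.comp (ofKel q).1.toContinuousMap‖ = 0 :=
        norm_exAlt_eq_zero h'
      have hz : execParam _ _ p = z := Subtype.ext (norm_exBump_exPt hφ h)
      rw [execLift_apply_D₂ h0, hz, hq, h, exF_exPt, exHeight_exVia_D₂]

theorem exF_isTrivialQFibration : IsTrivialQFibration exF := by
  have key : ∀ x ∈ exA.states, ∀ y ∈ exA.states,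
      Nonempty (IntervalFibration (MDSpace.execMap exF x y)) := by
    intro x hx y hy
    obtain ⟨a, -, rfl⟩ := exA_states hx
    obtain ⟨b, -, rfl⟩ := exA_states hy
    by_cases h : a = exVert 0 ∧ b = exVert 3
    · obtain ⟨rfl, rfl⟩ := h
      exact ⟨execFibration⟩
    · exact ⟨execFibrationOfNe a b h⟩
  exact ⟨fun x hx y hy => (key x hx y hy).some.isSerreFibration, exF_bijOn,
    fun x hx y hy => (key x hx y hy).some.isWeakHomotopyEquiv⟩

/-! ### The trace spaces -/

theorem exists_isReparam_lerp {u v : I} (huv : u < v) {ψ : I → I} (hm : Monotone ψ)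
    (hc : Continuous ψ) (h0 : ψ 0 = u) (h1 : ψ 1 = v) :
    ∃ φ, IsReparam φ ∧ ∀ t, ψ t = lerp u v (φ t) := by
  have huv' : 0 < (v : ℝ) - u := sub_pos.2 huv
  have hl (t : I) : (u : ℝ) ≤ ψ t := h0 ▸ hm nonneg'
  have hr (t : I) : (ψ t : ℝ) ≤ v := h1 ▸ hm le_one'
  refine ⟨fun t => ⟨((ψ t : ℝ) - u) / (v - u), div_nonneg (sub_nonneg.2 (hl t)) huv'.le,
    (div_le_one huv').2 (sub_le_sub_right (hr t) _)⟩, .of (fun s t hst => ?_) ?_ ?_ ?_, fun t => ?_⟩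
  · have : (ψ s : ℝ) ≤ ψ t := hm hst
    exact Subtype.mk_le_mk.2 (by gcongr)
  · exact Continuous.subtype_mk (by fun_prop) _
  · exact Subtype.ext (by simp [h0])
  · refine Subtype.ext ?_
    change ((ψ 1 : ℝ) - u) / (v - u) = 1
    rw [h1, div_self huv'.ne']
  · refine Subtype.ext ?_
    change (ψ t : ℝ) = (1 - ((ψ t : ℝ) - u) / (v - u)) * u + ((ψ t : ℝ) - u) / (v - u) * v
    field_simp
    ring

theorem lerp_mono {u v : I} (huv : u ≤ v) : Monotone (lerp u v) := fun s t hst => by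
  have hst' : (s : ℝ) ≤ t := hst
  have huv' : (u : ℝ) ≤ v := huv
  refine Subtype.mk_le_mk.2 ?_
  nlinarith

/-- The restriction of an execution path to the interval `[u,v]`, with prescribed ends. -/
def segment {X : MDSpace} {a b : X.carrier} (e : Path a b) (u v : I) {x y : X.carrier}
    (hx : e u = x) (hy : e v = y) : Path x y where
  toFun t := e (lerp u v t)
  continuous_toFun := e.continuous.comp
    (continuous_lerp continuous_const continuous_const continuous_id)
  source' := by rw [lerp_zero, hx]
  target' := by rw [lerp_one, hy]

theorem segment_mem {X : MDSpace} {a b : X.carrier} {e : Path a b} (he : e ∈ X.exec a b)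
    {u v : I} (huv : u ≤ v) {x y : X.carrier} (hx : e u = x) (hy : e v = y) :
    segment e u v hx hy ∈ (sp X).dpath x y :=
  .inr (.piece zero_lt_one e he _ (lerp_mono huv)
    (continuous_lerp continuous_const continuous_const continuous_id) fun _ _ => rfl)

theorem exists_directedPath {X : MDSpace} {x y : X.carrier} (τ : Trace (sp X) x y) :
    ∃ (p : Path (X := X.carrier) x y) (hp : IsDirectedPath X p),
      τ = Trace.mk (X := sp X) p hp :=
  τ.exists_mk

/-- A directed path which factors through an execution path `e` by a non-decreasing time function
has the same trace as the segment of `e` with the same ends. -/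
theorem mk_eq_segment {X : MDSpace} {a b : X.carrier} {e : Path a b} (he : e ∈ X.exec a b)
    {u v : I} (huv : u < v) {x y : X.carrier} (hx : e u = x) (hy : e v = y) {p : Path x y}
    (hp : IsDirectedPath X p) {ψ : I → I} (hm : Monotone ψ) (hc : Continuous ψ) (h0 : ψ 0 = u)
    (h1 : ψ 1 = v) (h : ∀ t, p t = e (ψ t)) :
    Trace.mk (X := sp X) p hp = Trace.mk (segment e u v hx hy) (segment_mem he huv.le hx hy) := by
  obtain ⟨φ, hφ, hψ⟩ := exists_isReparam_lerp huv hm hc h0 h1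
  exact (Trace.sound _ _ φ hφ fun t => (h t).trans (congrArg e (hψ t))).symm

/-- A directed path of `exA` which starts inside the execution path `t ↦ (1,t)` remains on this
path as long as it does not reach the final state. -/
theorem exPt_one_of_mooreChain {γ : I → exA.carrier} {a b : I} (h : MooreChain exA γ a b)
    (ha : γ a = exPt 1 (exTime (γ a))) (ha0 : 0 < exTime (γ a)) (hb : exTime (γ b) < 1) :
    ∀ t ∈ Set.Icc a b, γ t = exPt 1 (exTime (γ t)) := by
  induction h with
  | @piece a b hab x y e he φ hm hc hφ =>
    have hpos : 0 < exBump (γ a) := by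
      have h1 : exTime (γ a) < 1 := by
        refine lt_of_le_of_lt ?_ hb
        rw [hφ a ⟨le_rfl, hab.le⟩, hφ b ⟨hab.le, le_rfl⟩]
        exact exTime_exec he (hm hab.le)
      rw [ha, exBump_exPt]
      have := mul_pos (show 0 < (exTime (γ a) : ℝ) from ha0) (sub_pos.2 (show
        (exTime (γ a) : ℝ) < 1 from h1))
      change 0 < (1 : ℝ) * _
      linarith
    rcases exA_exec he with ⟨_, _, q, -, h⟩ | ⟨-, z, ψ, -, h⟩
    · rw [hφ a ⟨le_rfl, hab.le⟩, h, exBump_exI] at hpos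
      exact absurd hpos (lt_irrefl _)
    · have h' : ∀ t ∈ Set.Icc a b, γ t = exPt z (exTime (γ t)) := fun t ht => by
        rw [hφ t ht, h, exTime_exPt]
      -- comparing the values of `exBump` at the point `γ a` gives `z = 1`
      have hz : z = 1 := by
        have h1 := congrArg exBump ha
        have h2 := congrArg exBump (h' a ⟨le_rfl, hab.le⟩)
        rw [exBump_exPt] at h1 h2
        have h3 : (1 : ℝ) * (4 * ((exTime (γ a) : ℝ) * (1 - exTime (γ a)))) =
          z * (4 * ((exTime (γ a) : ℝ) * (1 - exTime (γ a)))) := h1.symm.trans h2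
        rw [h2] at hpos
        exact Subtype.ext (mul_right_cancel₀ (right_ne_zero_of_mul hpos.ne') h3).symm
      rwa [hz] at h'
  | @comp a m b h1 h2 ih1 ih2 =>
    have hle1 : exTime (γ a) ≤ exTime (γ m) :=
      h1.monotoneOn (h := exTime) (fun _ => exTime_exec) ⟨le_rfl, h1.lt.le⟩ ⟨h1.lt.le, le_rfl⟩
        h1.lt.le
    have hle2 : exTime (γ m) ≤ exTime (γ b) :=
      h2.monotoneOn (h := exTime) (fun _ => exTime_exec) ⟨le_rfl, h2.lt.le⟩ ⟨h2.lt.le, le_rfl⟩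
        h2.lt.le
    have ih1 := ih1 ha ha0 (hle2.trans_lt hb)
    have ih2 := ih2 (ih1 m ⟨h1.lt.le, le_rfl⟩) (ha0.trans_le hle1) hb
    intro t ht
    rcases le_total t m with h | h
    · exact ih1 t ⟨ht.1, h⟩
    · exact ih2 t ⟨h, ht.2⟩

/-- The execution path `t ↦ (1,t)`. -/
def freePath : Path (exC.map (globState false)) (exC.map (globState true)) :=
  (globPath (1 : I)).map exC.map.continuous

theorem freePath_mem : freePath ∈ exA.exec _ _ := exC.map_exec _ (globPath_mem 1)

theorem freePath_apply (t : I) : freePath t = exPt 1 t := rfl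

theorem subsingleton_trace_exA {u v : I} (hu : 0 < u) (huv : u < v) (hv : v < 1) :
    Subsingleton (Trace (sp exA) (exPt 1 u) (exPt 1 v)) := by
  have key (τ : Trace (sp exA) (exPt 1 u) (exPt 1 v)) : τ = Trace.mk _
      (segment_mem freePath_mem huv.le (freePath_apply u) (freePath_apply v)) := by
    obtain ⟨p, hp, rfl⟩ := exists_directedPath τ
    have h0 : exTime (p 0) = u := by rw [p.source, exTime_exPt]
    have h1 : exTime (p 1) = v := by rw [p.target, exTime_exPt]
    have hm : Monotone fun t => exTime (p t) :=
      IsDirectedPath.monotone (h := exTime) (fun _ => exTime_exec) hp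
    refine mk_eq_segment freePath_mem huv _ _ hp hm (exTime.continuous.comp p.continuous) h0 h1
      fun t => ?_
    rcases hp with hp | hp
    -- a constant path has equal ends
    · exact absurd (h0.symm.trans ((congrArg exTime ((hp 0).trans (hp 1).symm)).trans h1)) huv.ne
    · refine exPt_one_of_mooreChain hp ?_ ?_ ?_ t ⟨nonneg', le_one'⟩
      · rw [h0, p.source]
      · rwa [h0]
      · rwa [h1]
  exact ⟨fun τ τ' => (key τ).trans (key τ').symm⟩

theorem exB_exec_monotone {x y : exB.carrier} (p : Path x y) (hp : p ∈ exB.exec x y) :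
    Monotone fun t => exHeight (p t) := (exB_exec hp).1

/-- The maximum of the absolute value of a continuous function along a trace. -/
def traceNorm {X : DirSpace} (h : C(X.carrier, ℝ)) (x y : X.carrier) : C(Trace X x y, ℝ) where
  toFun := Quot.lift (fun p => ‖h.comp (ofKel p).1.toContinuousMap‖) (by
    rintro p q ⟨φ, hφ, hpq⟩
    refine le_antisymm ?_ ?_
    · refine (ContinuousMap.norm_le _ (norm_nonneg _)).2 fun t => ?_
      obtain ⟨s, rfl⟩ := hφ.2 t
      refine le_of_eq_of_le ?_ ((h.comp (ofKel q).1.toContinuousMap).norm_coe_le_norm s)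
      exact congrArg (fun x => ‖h x‖) (hpq s).symm
    · refine (ContinuousMap.norm_le _ (norm_nonneg _)).2 fun t => ?_
      refine le_of_eq_of_le ?_ ((h.comp (ofKel p).1.toContinuousMap).norm_coe_le_norm (φ t))
      exact congrArg (fun x => ‖h x‖) (hpq t))
  continuous_toFun := continuous_quot_lift _ ((continuous_norm_comp h).comp
    (continuous_subtype_val.comp Topology.WithGeneratedByTopology.continuous_equiv))

/-- The function on traces which takes the value `0` on those which run through `d₂` and the value
`1` on those which run through `d₄`. -/
def traceAlt (x y : exB.carrier) : C(Trace (sp exB) x y, ℝ) := traceNorm (X := sp exB) exAlt x y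

theorem traceAlt_mk {x y : exB.carrier} {p : Path x y} (hp : IsDirectedPath exB p) :
    traceAlt x y (Trace.mk (X := sp exB) p hp) = ‖exAlt.comp p.toContinuousMap‖ := rfl

/-- From a point below the two edges from `1` to `2` to a point above them, there are two traces,
and they lie in different path components. -/
theorem card_zerothHomotopy_trace_exB {x y : exB.carrier} (hx : (exHeight x : ℝ) ≤ 1 / 4)
    (hy : 1 / 2 ≤ (exHeight y : ℝ)) :
    Nat.card (ZerothHomotopy (Trace (sp exB) x y)) = 2 := by
  have hxy : exHeight x < exHeight y := show (exHeight x : ℝ) < exHeight y by linarith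
  have hx0 : exSide x = 0 := by
    by_contra h
    exact absurd (exHeight_of_exSide_ne h).1 (not_lt.2 hx)
  have hy0 : exSide y = 0 := by
    by_contra h
    exact absurd (exHeight_of_exSide_ne h).2 (not_lt.2 hy)
  let τ₂ : Trace (sp exB) x y := Trace.mk _ (segment_mem (exVia_mem exD₂_mem) hxy.le
    (exVia_D₂_of_exSide hx0.le) (exVia_D₂_of_exSide hy0.le))
  let τ₄ : Trace (sp exB) x y := Trace.mk _ (segment_mem (exVia_mem exD₄_mem) hxy.le
    (exVia_D₄_of_exSide hx0.ge) (exVia_D₄_of_exSide hy0.ge))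
  have key (τ : Trace (sp exB) x y) :
      (traceAlt x y τ = 0 ∧ τ = τ₂) ∨ (traceAlt x y τ = 1 ∧ τ = τ₄) := by
    obtain ⟨p, hp, rfl⟩ := exists_directedPath τ
    have hm : Monotone fun t => exHeight (p t) :=
      IsDirectedPath.monotone (h := exHeight) exB_exec_monotone hp
    have hc : Continuous fun t => exHeight (p t) := exHeight.continuous.comp p.continuous
    have h0 : exHeight (p 0) = exHeight x := by rw [p.source]
    have h1 : exHeight (p 1) = exHeight y := by rw [p.target]
    rw [traceAlt_mk]
    refine (exVia_cases p hm hx hy).imp (fun h => ⟨h.1, ?_⟩) fun h => ⟨h.1, ?_⟩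
    · exact mk_eq_segment (exVia_mem exD₂_mem) hxy _ _ hp hm hc h0 h1 fun t => (h.2 t).symm
    · exact mk_eq_segment (exVia_mem exD₄_mem) hxy _ _ hp hm hc h0 h1 fun t => (h.2 t).symm
  have h₂ : traceAlt x y τ₂ = 0 :=
    (traceAlt_mk _).trans (norm_exAlt_eq_zero fun _ => exSide_exVia_D₂ _)
  have h₄ : traceAlt x y τ₄ = 1 :=
    (traceAlt_mk _).trans (norm_exAlt_eq_one (fun _ => exSide_exVia_D₄ _) hx hy)
  refine Nat.card_eq_two_iff.2 ⟨.mk τ₂, .mk τ₄, fun h => ?_, ?_⟩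
  · obtain ⟨P⟩ : Joined τ₂ τ₄ := Quotient.exact h
    obtain ⟨s, hs⟩ := intermediate_value_univ 0 1 ((traceAlt x y).continuous.comp P.continuous)
      (show (1 / 2 : ℝ) ∈ _ by
        simp only [Function.comp_apply, P.source, P.target, h₂, h₄]
        norm_num)
    rcases key (P s) with h | h
    · have := hs.symm.trans h.1
      norm_num at this
    · have := hs.symm.trans h.1
      norm_num at this
  · refine Set.eq_univ_of_forall ?_
    rintro ⟨τ⟩
    rcases key τ with h | h
    · exact .inl (congrArg _ h.2)
    · exact .inr (congrArg _ h.2)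

/-- The trace of the segment of the free execution path from time `1/8` to time `3/4`, as an object
of the category of factorizations. The endpoints project inside `d₁` and inside `d₃`. -/
def exTrace : (nt exA).index where
  src := ⟨exPt 1 ⟨1 / 8, by norm_num, by norm_num⟩⟩
  tgt := ⟨exPt 1 ⟨3 / 4, by norm_num, by norm_num⟩⟩
  hom := Trace.mk _ (segment_mem freePath_mem (Subtype.mk_le_mk.2 (by norm_num))
    (freePath_apply _) (freePath_apply _))

theorem subsingleton_exTrace : Subsingleton ((nt exA).functor.obj exTrace) :=
  subsingleton_trace_exA (Subtype.mk_lt_mk.2 (by norm_num)) (Subtype.mk_lt_mk.2 (by norm_num))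
    (Subtype.mk_lt_mk.2 (by norm_num))

theorem contractibleSpace_exTrace : ContractibleSpace ((nt exA).functor.obj exTrace) :=
  have := subsingleton_exTrace
  have : Unique ((nt exA).functor.obj exTrace) := ⟨⟨exTrace.hom⟩, fun _ => Subsingleton.elim _ _⟩
  inferInstance

theorem card_exTrace :
    Nat.card (ZerothHomotopy ((nt exB).functor.obj ((ntMap exF).base.obj exTrace))) = 2 :=
  card_zerothHomotopy_trace_exB
    (le_of_eq_of_le (congrArg Subtype.val (exTime_exPt 1 ⟨1 / 8, by norm_num, by norm_num⟩))
      (by norm_num))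
    (le_of_le_of_eq (by norm_num)
      (congrArg Subtype.val (exTime_exPt 1 ⟨3 / 4, by norm_num, by norm_num⟩)).symm)

/-- The component of the map of natural systems at `exTrace` goes from a point to a space with two
path components. -/
theorem not_isOpenUpToHomotopy : ¬ (ntMap exF).IsOpenUpToHomotopy := by
  rintro ⟨-, -, h⟩
  have h1 : IsIso (((ntMap exF).comp toHo).nat.app exTrace) :=
    (NatTrans.isIso_iff_isIso_app _).1 h exTrace
  have h2 : IsIso (toHo.map ((ntMap exF).nat.app exTrace)) := h1
  have h3 := Nat.card_congr
    (Equiv.ofBijective _ (zerothMap_bijective_of_isIso_toHo ((ntMap exF).nat.app exTrace)))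
  have := subsingleton_exTrace
  have h4 : Subsingleton (ZerothHomotopy ((nt exA).functor.obj exTrace)) :=
    inferInstanceAs (Subsingleton (Quotient _))
  have h5 : Nat.card (ZerothHomotopy ((nt exA).functor.obj exTrace)) ≤ 1 :=
    Finite.card_le_one_iff_subsingleton.2 h4
  exact absurd ((h3.trans card_exTrace).ge.trans h5) (by norm_num)

end DAT

theorem proposition9p1 :
    ∃ (A B : DAT.MDSpace) (r : DAT.TameRealization DAT.exampleSet B)
      (g : DAT.glob PUnit ⟶ B) (c : DAT.glob I ⟶ A) (i : B ⟶ A) (f : A ⟶ B),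
      A.IsCellular ∧ B.IsCellular ∧
      (∀ t : I, g.map (DAT.globPt PUnit.unit t) = DAT.longPath r t) ∧
      IsPushout g (DAT.globMap (ContinuousMap.const PUnit (0 : I))) i c ∧
      i ≫ f = 𝟙 B ∧
      c ≫ f = DAT.globMap (ContinuousMap.const I PUnit.unit) ≫ g ∧
      DAT.IsTrivialQFibration f ∧
      (∃ γ : (DAT.nt A).index,
        ContractibleSpace ((DAT.nt A).functor.obj γ) ∧
        Nat.card (ZerothHomotopy ((DAT.nt B).functor.obj ((DAT.ntMap f).base.obj γ))) = 2) ∧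
      ¬ (DAT.ntMap f).IsOpenUpToHomotopy :=
  have hB : DAT.FiniteAttachment (DAT.MDSpace.discrete (Fin 4)) DAT.exB :=
    DAT.TameRealization.finiteAttachment
      (DAT.realizationTame (DAT.exSrc : Fin (3 + 1) → Fin 4) DAT.exTgt)
  ⟨DAT.exA, DAT.exB, DAT.exTame, DAT.exG, DAT.exC, DAT.exI, DAT.exF,
    (hB.attachInterval DAT.exG).isCellular, hB.isCellular, fun _ => rfl,
    DAT.att_isPushout DAT.exG, rfl, rfl, DAT.exF_isTrivialQFibration,
    ⟨DAT.exTrace, DAT.contractibleSpace_exTrace, DAT.card_exTrace⟩, DAT.not_isOpenUpToHomotopy⟩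

end
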